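/- Let $d\ge 1$ and $\mathbb I=[0,1]$. A $d$-variate quasi-copula is a function $A:\mathbb I^d\to\mathbb I$ with uniform margins ($A(1,\dots,1,u_j,1,\dots,1)=u_j$ for every $j$) that is increasing and $1$-Lipschitz in each variable. Let $\mathcal Q_d$ be the set of all $d$-variate quasi-copulas, equipped with the uniform distance $\|A-B\|_\infty=\sup_{\mathbf u\in\mathbb I^d}|A(\mathbf u)-B(\mathbf u)|$, and let $M\in\mathcal Q_d$, $M(\mathbf u)=\min(u_1,\dots,u_d)$. For $Q\in\mathcal Q_d$ let $\mu_Q$ be the finitely additive signed measure on the finite disjoint unions of half-open boxes $(x_1,y_1]\times\dots\times(x_d,y_d]\subseteq\mathbb I^d$ whose value on each such box is its $Q$-volume $\sum_{S\subseteq\{1,\dots,d\}}(-1)^{|S|}Q(\mathbf v^S)$, where $v^S_i=x_i$ for $i\in S$ and $v^S_i=y_i$ otherwise. A shuffle of $Q$ is a function $\mathbb I^d\to\mathbb R$ of the form $$\mathbf u\mapsto \mu_Q\bigl(\phi^{-1}((0,u_1]\times\dots\times(0,u_d])\bigr),\qquad \phi(\mathbf t)=(\phi_1(t_1),\dots,\phi_d(t_d)),$$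 where for each $k$ there are a positive integer $n$, points $0=a_0\le a_1\le\dots\le a_n=1$ and a permutation $\pi$ of $\{1,\dots,n\}$ (all depending on $k$) such that $\phi_k:\mathbb I\to\mathbb I$ satisfies $\phi_k(0)=0$ and $\phi_k(t)=t-a_{i-1}+\sum_{j:\,\pi(j)<\pi(i)}(a_j-a_{j-1})$ for $t\in(a_{i-1},a_i]$, $1\le i\le n$. A shuffle of a quasi-copula need not be a quasi-copula. Theorem. (1) For any $Q_1,Q_2\in\mathcal Q_d$ and any $\varepsilon>0$ there are $A_1,A_2\in\mathcal Q_d$ such that $\|Q_1-A_1\|_\infty<\varepsilon$, $\|Q_2-A_2\|_\infty<\varepsilon$, and $A_1$ is a shuffle of $A_2$. (2) For every neighborhood $U$ of $M$ in $\mathcal Q_d$, let $\mathcal S_U$ be the set of all shuffles of members of $U$. Then $\mathcal S_U\cap\mathcal Q_d$ is a dense subset of $\mathcal Q_d$. -/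

import Mathlib

open scoped unitInterval Topology

noncomputable section

/-- A function `A` on the unit cube `[0,1]^d` is a `d`-variate quasi-copula: it takes values in
`[0,1]`, has uniform margins, is increasing in each variable and `1`-Lipschitz in each variable. -/
structure IsQuasiCopula {d : ℕ} (A : (Fin d → I) → ℝ) : Prop where
  mem_Icc : ∀ u, A u ∈ Set.Icc (0 : ℝ) 1
  margin : ∀ (j : Fin d) (t : I), A (Function.update (fun _ => 1) j t) = t
  monotone : ∀ (j : Fin d) (u : Fin d → I), Monotone fun t : I => A (Function.update u j t)
  lipschitz : ∀ (j : Fin d) (u : Fin d → I) (s t : I),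
    |A (Function.update u j s) - A (Function.update u j t)| ≤ |(s : ℝ) - t|

/-- The half-open box `(x₁,y₁] × ⋯ × (x_d,y_d]` in the unit cube. -/
def halfOpenBox {d : ℕ} (x y : Fin d → I) : Set (Fin d → I) :=
  {t | ∀ i, x i < t i ∧ t i ≤ y i}

/-- The `A`-volume of the box with lower corner `x` and upper corner `y`: the alternating sum of `A`
over the vertices; `s` is the set of the coordinates in which the vertex agrees with `x`. -/
def boxVolume {d : ℕ} (A : (Fin d → I) → ℝ) (x y : Fin d → I) : ℝ :=
  ∑ s : Finset (Fin d), (-1) ^ s.card * A (fun i => if i ∈ s then x i else y i)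

/-- `S` is a finite disjoint union of half-open boxes, and the `Q`-volumes of these boxes add up
to `c`. (Degenerate boxes are allowed; they are empty and have volume zero.) -/
def HasMass {d : ℕ} (Q : (Fin d → I) → ℝ) (S : Set (Fin d → I)) (c : ℝ) : Prop :=
  ∃ (ι : Type) (_ : Fintype ι) (x y : ι → Fin d → I),
    (∀ k i, x k i ≤ y k i) ∧
    (∀ k l, k ≠ l → Disjoint (halfOpenBox (x k) (y k)) (halfOpenBox (x l) (y l))) ∧
    S = ⋃ k, halfOpenBox (x k) (y k) ∧
    c = ∑ k, boxVolume Q (x k) (y k)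

open Classical in
/-- The finitely additive signed measure `μ_Q` induced by `Q` on the algebra of finite disjoint
unions of half-open boxes: the extension of the volume `V_Q` (with the value `0` outside that
algebra). It is well defined for quasi-copulas, see `IsQuasiCopula.inducedMeasure_eq`. -/
def inducedMeasure {d : ℕ} (Q : (Fin d → I) → ℝ) (S : Set (Fin d → I)) : ℝ :=
  if h : ∃ c, HasMass Q S c then h.choose else 0

/-- `φ` is the map of `[0,1]` that rearranges the pieces `J_i = (a_{i-1}, a_i]` of the partition
`0 = a_0 ≤ a_1 ≤ ⋯ ≤ a_n = 1` according to the permutation `π`: it fixes `0` and translates `J_i`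
to the position behind all the pieces `J_j` with `π j < π i`. -/
structure IsSliceMap {n : ℕ} (a : Fin (n + 1) → I) (π : Equiv.Perm (Fin n)) (φ : I → I) :
    Prop where
  monotone : Monotone a
  first : a 0 = 0
  last : a (Fin.last n) = 1
  map_zero : φ 0 = 0
  map_piece : ∀ (i : Fin n) (t : I), a i.castSucc < t → t ≤ a i.succ →
    (φ t : ℝ) = t - a i.castSucc +
      ∑ j : Fin n with π j < π i, ((a j.succ : ℝ) - a j.castSucc)

/-- `A` is a shuffle of `Q`: there are a finite partition of `(0,1]` and a permutation of its pieces
for each coordinate such that, for the resulting coordinatewise map `φ` of the cube, `A` is the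
grounded function `u ↦ μ_Q (φ⁻¹ ((0,u₁] × ⋯ × (0,u_d]))` induced by the image of `μ_Q`. -/
def IsShuffle {d : ℕ} (A Q : (Fin d → I) → ℝ) : Prop :=
  ∃ (n : Fin d → ℕ) (a : ∀ k, Fin (n k + 1) → I) (π : ∀ k, Equiv.Perm (Fin (n k)))
    (φ : Fin d → I → I),
    (∀ k, IsSliceMap (a k) (π k) (φ k)) ∧
    ∀ u, A u = inducedMeasure Q ((fun t k => φ k (t k)) ⁻¹' halfOpenBox (fun _ => 0) u)

/-- The space of `d`-variate quasi-copulas, a subset of the space of continuous functions on the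
cube with the supremum norm; it carries the uniform distance. Continuity is automatic, see
`IsQuasiCopula.continuous`. -/
abbrev QuasiCopula (d : ℕ) : Type := {A : C(Fin d → I, ℝ) // IsQuasiCopula (d := d) A}

/-- The set of all shuffles of members of a set `U` of quasi-copulas; shuffles are just functions
on the cube and need not be quasi-copulas. -/
def shufflesOf {d : ℕ} (U : Set (QuasiCopula d)) : Set ((Fin d → I) → ℝ) :=
  {A | ∃ B ∈ U, IsShuffle A B.1}

theorem IsQuasiCopula.abs_sub_le {d : ℕ} {A : (Fin d → I) → ℝ} (hA : IsQuasiCopula A)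
    (u v : Fin d → I) : |A u - A v| ≤ ∑ i, |(u i : ℝ) - v i| := by
  classical
  have key : ∀ s : Finset (Fin d),
      |A (fun i => if i ∈ s then u i else v i) - A v| ≤ ∑ i ∈ s, |(u i : ℝ) - v i| := by
    intro s
    induction s using Finset.induction_on with
    | empty => simp
    | insert j s hj ih =>
      rw [Finset.sum_insert hj]
      set w : Fin d → I := fun i => if i ∈ s then u i else v i with hw
      have h1 : (fun i => if i ∈ insert j s then u i else v i) = Function.update w j (u j) := by
        funext i
        by_cases hi : i = j
        · subst hi; simp
        · simp [hi, hw]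
      have h2 : w = Function.update w j (v j) := by
        funext i
        by_cases hi : i = j
        · subst hi; simp [hw, hj]
        · simp [hi]
      have h3 := hA.lipschitz j w (u j) (v j)
      rw [← h2] at h3
      rw [h1]
      calc |A (Function.update w j (u j)) - A v|
          ≤ |A (Function.update w j (u j)) - A w| + |A w - A v| := _root_.abs_sub_le _ _ _
        _ ≤ _ := add_le_add h3 ih
  simpa using key Finset.univ

theorem IsQuasiCopula.continuous {d : ℕ} {A : (Fin d → I) → ℝ} (hA : IsQuasiCopula A) :
    Continuous A := by
  rw [continuous_iff_continuousAt]
  intro v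
  have h0 : Filter.Tendsto (fun u : Fin d → I => ∑ i, |(u i : ℝ) - v i|) (𝓝 v) (𝓝 0) := by
    have hc : Continuous (fun u : Fin d → I => ∑ i, |(u i : ℝ) - v i|) := by fun_prop
    simpa using hc.tendsto v
  have h1 := squeeze_zero (fun u => abs_nonneg (A u - A v)) (fun u => hA.abs_sub_le u v) h0
  exact tendsto_sub_nhds_zero_iff.mp ((tendsto_zero_iff_abs_tendsto_zero _).mpr h1)

theorem IsQuasiCopula.mono {d : ℕ} {A : (Fin d → I) → ℝ} (hA : IsQuasiCopula A) :
    Monotone A := by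
  classical
  intro u v huv
  have key : ∀ s : Finset (Fin d), A u ≤ A (fun i => if i ∈ s then v i else u i) := by
    intro s
    induction s using Finset.induction_on with
    | empty => simp
    | insert j s hj ih =>
      set w : Fin d → I := fun i => if i ∈ s then v i else u i with hw
      have h1 : (fun i => if i ∈ insert j s then v i else u i) = Function.update w j (v j) := by
        funext i
        by_cases hi : i = j
        · subst hi; simp
        · simp [hi, hw]
      have h2 : Function.update w j (u j) = w := by
        funext i
        by_cases hi : i = j
        · subst hi; simp [hw, hj]
        · simp [hi]
      have h3 := hA.monotone j w (huv j)
      simp only [h2] at h3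
      rw [h1]
      exact ih.trans h3
  simpa using key Finset.univ

/-- Quasi-copulas are grounded. -/
theorem IsQuasiCopula.grounded {d : ℕ} {A : (Fin d → I) → ℝ} (hA : IsQuasiCopula A)
    (u : Fin d → I) (j : Fin d) (hj : u j = 0) : A u = 0 := by
  refine le_antisymm ?_ (hA.mem_Icc u).1
  have h := hA.margin j 0
  rw [Set.Icc.coe_zero] at h
  rw [← h]
  refine hA.mono fun i => ?_
  by_cases hi : i = j
  · subst hi; simp [hj]
  · simpa [hi] using unitInterval.le_one'

/-- A combination of indicators of the boxes `(0,y]` determines its coefficients, as far as the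
boxes are not empty. -/
theorem finsupp_sum_eq_zero_of_grounded {d : ℕ} {Q : (Fin d → I) → ℝ}
    (hQ : ∀ (u : Fin d → I) (j : Fin d), u j = 0 → Q u = 0)
    (f : (Fin d → I) →₀ ℝ)
    (hf : ∀ t, f.sum (fun y c => c * (halfOpenBox (fun _ => 0) y).indicator 1 t) = 0) :
    f.sum (fun y c => c * Q y) = 0 := by
  classical
  have key : ∀ y, (∀ i, 0 < y i) → f y = 0 := by
    by_contra! hne
    obtain ⟨y, hy, hfy⟩ := hne
    set T := f.support.filter (fun y => ∀ i, 0 < y i) with hT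
    have hyT : y ∈ T := by simp [hT, hy, hfy]
    obtain ⟨z, -, hz⟩ := T.exists_le_maximal hyT
    have hzT := hz.1
    simp only [hT, Finset.mem_filter, Finsupp.mem_support_iff] at hzT
    have h := hf z
    rw [Finsupp.sum, Finset.sum_eq_single z] at h
    · rw [Set.indicator_of_mem (fun i => ⟨hzT.2 i, le_rfl⟩)] at h
      simp at h
      exact hzT.1 h
    · intro w hw hwz
      rw [Set.indicator_of_notMem, mul_zero]
      intro hmem
      have hle : z ≤ w := fun i => (hmem i).2
      have hwT : w ∈ T := by
        simp only [hT, Finset.mem_filter]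
        exact ⟨hw, fun i => (hmem i).1.trans_le (hle i)⟩
      exact hwz (le_antisymm (hz.2 hwT hle) hle)
    · intro hz'
      simp at hz'
      simp [hz']
  refine Finset.sum_eq_zero fun y _ => ?_
  by_cases hy : ∀ i, 0 < y i
  · simp [key y hy]
  · push Not at hy
    obtain ⟨i, hi⟩ := hy
    simp [hQ y i (le_antisymm hi unitInterval.nonneg')]

theorem boxVolume_indicator {d : ℕ} (x y : Fin d → I) (hxy : ∀ i, x i ≤ y i) (t : Fin d → I) :
    boxVolume (fun v => (halfOpenBox (fun _ => 0) v).indicator 1 t) x y =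
      (halfOpenBox x y).indicator 1 t := by
  classical
  have hind : ∀ u v : Fin d → I, ((halfOpenBox u v).indicator 1 t : ℝ) =
      ∏ i, (if u i < t i ∧ t i ≤ v i then (1 : ℝ) else 0) := by
    intro u v
    by_cases h : t ∈ halfOpenBox u v
    · rw [Set.indicator_of_mem h, Finset.prod_eq_one]
      · rfl
      · intro i _
        exact if_pos (h i)
    · rw [Set.indicator_of_notMem h]
      have h' : ¬ ∀ i, u i < t i ∧ t i ≤ v i := h
      push Not at h'
      obtain ⟨i, hi⟩ := h'
      rw [Finset.prod_eq_zero (Finset.mem_univ i)]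
      rw [if_neg]
      rintro ⟨h1, h2⟩
      exact absurd h2 (not_le.mpr (hi h1))
  have hfac : ∀ i, (if x i < t i ∧ t i ≤ y i then (1 : ℝ) else 0) =
      -(if 0 < t i ∧ t i ≤ x i then (1 : ℝ) else 0) +
        (if 0 < t i ∧ t i ≤ y i then (1 : ℝ) else 0) := by
    intro i
    have h0 : (0 : I) ≤ x i := unitInterval.nonneg'
    have h1 := hxy i
    rcases lt_or_ge (x i) (t i) with h | h
    · have h2 : 0 < t i := h0.trans_lt h
      simp [h, h2, not_le.mpr h]
    · have h2 : t i ≤ y i := h.trans h1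
      simp [h, h2, not_lt.mpr h]
  rw [hind, Finset.prod_congr rfl fun i _ => hfac i, Finset.prod_add, boxVolume,
    Finset.powerset_univ]
  refine Finset.sum_congr rfl fun s _ => ?_
  rw [hind, Finset.prod_neg, mul_assoc]
  congr 1
  rw [← Finset.prod_mul_prod_compl s, Finset.compl_eq_univ_sdiff]
  congr 1
  · exact Finset.prod_congr rfl fun i hi => by simp [hi]
  · exact Finset.prod_congr rfl fun i hi => by simp [(Finset.mem_sdiff.mp hi).2]

/-- The sum of the volumes does not depend on the decomposition into boxes. -/
theorem HasMass.unique {d : ℕ} {Q : (Fin d → I) → ℝ}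
    (hQ : ∀ (u : Fin d → I) (j : Fin d), u j = 0 → Q u = 0)
    {S : Set (Fin d → I)} {c c' : ℝ} (h : HasMass Q S c) (h' : HasMass Q S c') : c = c' := by
  classical
  let F : (Fin d → I) → (Fin d → I) → ((Fin d → I) →₀ ℝ) := fun x y =>
    ∑ s : Finset (Fin d), Finsupp.single (fun i => if i ∈ s then x i else y i) ((-1) ^ s.card)
  have hF : ∀ (g : (Fin d → I) → ℝ) x y,
      Finsupp.linearCombination ℝ g (F x y) = boxVolume g x y := by
    intro g x y
    simp [F, boxVolume, map_sum, Finsupp.linearCombination_single]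
  have hrep : ∀ c, HasMass Q S c → ∃ f : (Fin d → I) →₀ ℝ,
      Finsupp.linearCombination ℝ Q f = c ∧ ∀ t, Finsupp.linearCombination ℝ
        (fun v => ((halfOpenBox (fun _ => 0) v).indicator 1 t : ℝ)) f = S.indicator 1 t := by
    rintro c ⟨ι, _, x, y, hle, hdis, rfl, rfl⟩
    refine ⟨∑ k, F (x k) (y k), by simp only [map_sum, hF], fun t => ?_⟩
    rw [map_sum]
    simp only [hF, boxVolume_indicator _ _ (hle _) t]
    by_cases ht : t ∈ ⋃ k, halfOpenBox (x k) (y k)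
    · rw [Set.indicator_of_mem ht]
      obtain ⟨k, hk⟩ := Set.mem_iUnion.mp ht
      rw [Finset.sum_eq_single k, Set.indicator_of_mem hk]
      · intro l _ hl
        exact Set.indicator_of_notMem (fun hl' => (hdis l k hl).le_bot ⟨hl', hk⟩) _
      · simp
    · rw [Set.indicator_of_notMem ht]
      exact Finset.sum_eq_zero fun k _ =>
        Set.indicator_of_notMem (fun hk => ht (Set.mem_iUnion.mpr ⟨k, hk⟩)) _
  obtain ⟨f, hfc, hft⟩ := hrep c h
  obtain ⟨f', hfc', hft'⟩ := hrep c' h'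
  have := finsupp_sum_eq_zero_of_grounded hQ (f - f') (fun t => by
    have h1 := map_sub (Finsupp.linearCombination ℝ
      (fun v => ((halfOpenBox (fun _ => 0) v).indicator 1 t : ℝ))) f f'
    rw [hft, hft', sub_self] at h1
    simpa [Finsupp.linearCombination_apply] using h1)
  have h2 := map_sub (Finsupp.linearCombination ℝ Q) f f'
  rw [hfc, hfc', Finsupp.linearCombination_apply] at h2
  simp only [smul_eq_mul] at h2
  linarith

/-- For a quasi-copula `Q`, the value `μ_Q S` is the sum of the `Q`-volumes of the boxes in any
decomposition of `S` into finitely many disjoint half-open boxes. -/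
theorem IsQuasiCopula.inducedMeasure_eq {d : ℕ} {Q : (Fin d → I) → ℝ} (hQ : IsQuasiCopula Q)
    {S : Set (Fin d → I)} {c : ℝ} (h : HasMass Q S c) : inducedMeasure Q S = c := by
  have hex : ∃ c, HasMass Q S c := ⟨c, h⟩
  rw [inducedMeasure, dif_pos hex]
  exact hex.choose_spec.unique hQ.grounded h

theorem isQuasiCopula_min (d : ℕ) [NeZero d] :
    IsQuasiCopula fun u : Fin d → I =>
      Finset.univ.inf' Finset.univ_nonempty fun i => (u i : ℝ) := by
  classical
  refine ⟨fun u => ⟨?_, ?_⟩, fun j t => ?_, fun j u s t hst => ?_, fun j u s t => ?_⟩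
  · exact Finset.le_inf' _ _ fun i _ => (u i).2.1
  · exact (Finset.inf'_le _ (Finset.mem_univ 0)).trans (u 0).2.2
  · refine le_antisymm ((Finset.inf'_le _ (Finset.mem_univ j)).trans (by simp)) ?_
    refine Finset.le_inf' _ _ fun i _ => ?_
    by_cases hi : i = j
    · subst hi; simp
    · simpa [hi] using t.2.2
  · refine Finset.le_inf' _ _ fun i _ => (Finset.inf'_le _ (Finset.mem_univ i)).trans ?_
    by_cases hi : i = j
    · subst hi; simpa using hst
    · simp [hi]
  · have key : ∀ s t : I,
        (Finset.univ.inf' Finset.univ_nonempty fun i => (Function.update u j s i : ℝ)) ≤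
        (Finset.univ.inf' Finset.univ_nonempty fun i => (Function.update u j t i : ℝ)) +
          |(s : ℝ) - t| := by
      intro s t
      rw [← sub_le_iff_le_add]
      refine Finset.le_inf' _ _ fun i _ => ?_
      rw [sub_le_iff_le_add]
      refine (Finset.inf'_le _ (Finset.mem_univ i)).trans ?_
      by_cases hi : i = j
      · subst hi
        simp only [Function.update_self]
        linarith [le_abs_self ((s : ℝ) - t)]
      · simp only [Function.update_of_ne hi]
        linarith [abs_nonneg ((s : ℝ) - t)]
    have h1 := key s t
    have h2 := key t s
    rw [abs_sub_comm] at h2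
    rw [_root_.abs_le]
    constructor <;> linarith

/-- The upper Fréchet–Hoeffding bound `M(u) = min (u₁, …, u_d)`. -/
def minCopula (d : ℕ) [NeZero d] : QuasiCopula d :=
  ⟨⟨fun u => Finset.univ.inf' Finset.univ_nonempty fun i => (u i : ℝ),
    (isQuasiCopula_min d).continuous⟩, isQuasiCopula_min d⟩

end

/-! ### Sums of products -/

/-! Cut the cube into `N ^ d` cells, and let `q₁`, `q₂` be the signed cell masses of `Q₁`, `Q₂`.
Look for one signed weight on pairs `(i, j)` of cell indices with marginals near `q₁` and `q₂`. Cut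
each axis into `N * N` pieces, numbered by pairs. If the first index is the more significant one,
the weight spread uniformly over the fine cells has a distribution function `A₁` that sees only the
first marginal at coarse corners, so it is near `Q₁`. The other order gives `A₂` near `Q₂`. Changing
the order permutes the pieces of each axis, so `A₁` is a shuffle of `A₂` (`isShuffle_gridFun`).

The difficulty is to make both functions quasi-copulas. The product `q₁ i * q₂ j` of signed weights
need not work. Instead, `interlace` is bilinear in deviations from the uniform weight `1 / N ^ d`
and a positive weight `ρ`, so no product of `q₁` with `q₂` occurs. By `isQuasiCopula_gridFun` it is
enough that every fine slice has distribution function between `0` and `1 / N ^ 2`. In such a slice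
the terms with `q₁ i * ρ j` have the right sign. The terms with `ρ i * (q₂ j - 1 / N ^ d)` cancel
except for `i` on at most `d` hyperplanes, those of the coarse cells cut by the evaluation point;
they contribute at most `d / N` times `1 / N ^ 2`. The uniform part leaves a slack of order `δ`,
which absorbs this error because `ρ` is at most `1 - δ` times uniform and vanishes near the boundary
(`IsLexKernel.sum_sum_interlace_mem`). As `δ` tends to `0` and `N` grows, the mass of `ρ` tends to
`1` and the approximation becomes arbitrarily good.

The second assertion is the first one with `Q₂ = M`. -/

theorem sum_prod_apply {κ α : Type*} [Fintype κ] [DecidableEq κ] [Fintype α]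
    (f : κ → α → ℝ) : ∑ i : κ → α, ∏ k, f k (i k) = ∏ k, ∑ a, f k a :=
  (Fintype.prod_sum f).symm

theorem sum_sum_prod_apply {κ α β : Type*} [Fintype κ] [DecidableEq κ] [Fintype α] [Fintype β]
    (f : κ → α → β → ℝ) :
    ∑ i : κ → α, ∑ j : κ → β, ∏ k, f k (i k) (j k) = ∏ k, ∑ a, ∑ b, f k a b := by
  rw [← sum_prod_apply]
  exact Finset.sum_congr rfl fun i _ => sum_prod_apply fun k => f k (i k)

theorem boxVolume_prod {d : ℕ} (f : Fin d → I → ℝ) (x y : Fin d → I) :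
    boxVolume (fun v => ∏ k, f k (v k)) x y = ∏ k, (f k (y k) - f k (x k)) := by
  have h : ∀ k, f k (y k) - f k (x k) = -f k (x k) + f k (y k) := fun k => by ring
  rw [Finset.prod_congr rfl fun k _ => h k, Finset.prod_add, boxVolume, Finset.powerset_univ]
  refine Finset.sum_congr rfl fun s _ => ?_
  rw [Finset.prod_neg, mul_assoc]
  congr 1
  rw [← Finset.prod_mul_prod_compl s, Finset.compl_eq_univ_sdiff]
  congr 1
  · exact Finset.prod_congr rfl fun i hi => by simp [hi]
  · exact Finset.prod_congr rfl fun i hi => by simp [(Finset.mem_sdiff.mp hi).2]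

theorem boxVolume_sum {d : ℕ} {ι : Type*} [Fintype ι] (m : ι → ℝ) (F : ι → (Fin d → I) → ℝ)
    (x y : Fin d → I) :
    boxVolume (fun v => ∑ p, m p * F p v) x y = ∑ p, m p * boxVolume (F p) x y := by
  simp only [boxVolume, Finset.mul_sum]
  rw [Finset.sum_comm]
  exact Finset.sum_congr rfl fun p _ => Finset.sum_congr rfl fun s _ => by ring

/-! ### Ramps -/

/-- The distribution function of the uniform distribution on `(i / n, (i + 1) / n]`. -/
noncomputable def ramp (n i : ℕ) (t : ℝ) : ℝ := max 0 (min 1 (n * t - i))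

theorem ramp_nonneg (n i : ℕ) (t : ℝ) : 0 ≤ ramp n i t := le_max_left _ _

theorem ramp_le_one (n i : ℕ) (t : ℝ) : ramp n i t ≤ 1 :=
  max_le zero_le_one (min_le_left _ _)

theorem ramp_mono (n i : ℕ) : Monotone (ramp n i) := fun s t h => by
  unfold ramp
  gcongr

theorem ramp_antitone_index (n : ℕ) (t : ℝ) : Antitone fun i => ramp n i t := fun i j h => by
  have : (i : ℝ) ≤ j := by exact_mod_cast h
  simp only [ramp]
  gcongr

theorem ramp_eq_zero {n i : ℕ} {t : ℝ} (h : n * t ≤ i) : ramp n i t = 0 :=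
  max_eq_left ((min_le_right _ _).trans (by linarith))

theorem ramp_eq_one {n i : ℕ} {t : ℝ} (h : (i : ℝ) + 1 ≤ n * t) : ramp n i t = 1 := by
  rw [ramp, min_eq_left (by linarith), max_eq_right zero_le_one]

theorem ramp_of_mem {n i : ℕ} {t v : ℝ} (h : n * t = i + v) (h0 : 0 ≤ v) (h1 : v ≤ 1) :
    ramp n i t = v := by
  rw [ramp, h, add_sub_cancel_left, min_eq_right h1, max_eq_right h0]

theorem sum_ramp (n : ℕ) (t : I) : ∑ i : Fin n, ramp n i t = n * (t : ℝ) := by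
  -- The first `m` ramps fill up the interval `[0, m / n]` and then stay constant.
  have key : ∀ m : ℕ, ∑ i ∈ Finset.range m, ramp n i t = min (m : ℝ) (n * t) := by
    have h0 : 0 ≤ n * (t : ℝ) := mul_nonneg n.cast_nonneg t.2.1
    intro m
    induction m with
    | zero => simpa using h0
    | succ m ih =>
      rw [Finset.sum_range_succ, ih, ramp]
      push_cast
      rcases le_total (n * (t : ℝ)) m with h | h
      · rw [min_eq_right h, min_eq_right (by linarith), min_eq_right (by linarith),
          max_eq_left (by linarith), add_zero]
      · rcases le_total (n * (t : ℝ)) (m + 1) with h' | h'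
        · rw [min_eq_left h, min_eq_right (by linarith), min_eq_right h',
            max_eq_right (by linarith)]
          ring
        · rw [min_eq_left h, min_eq_left (by linarith), min_eq_left h',
            max_eq_right zero_le_one]
  rw [Fin.sum_univ_eq_sum_range (fun i => ramp n i t) n, key]
  exact min_eq_right (mul_le_of_le_one_right n.cast_nonneg t.2.2)

/-! ### Functions with piecewise constant density -/

/-- The distribution function of the signed measure that spreads the mass `m p` uniformly over
the cell `∏ k, (e (p k) / n, (e (p k) + 1) / n]`. -/
noncomputable def gridFun {d n : ℕ} {ι : Type*} [Fintype ι] (e : ι ≃ Fin n)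
    (m : (Fin d → ι) → ℝ) (u : Fin d → I) : ℝ :=
  ∑ p, m p * ∏ k, ramp n (e (p k)) (u k)

section gridFun

variable {d n : ℕ} {ι : Type*} [Fintype ι] (e : ι ≃ Fin n) (m : (Fin d → ι) → ℝ)

theorem gridFun_of_eq_zero (u : Fin d → I) (j : Fin d) (hj : u j = 0) : gridFun e m u = 0 := by
  refine Finset.sum_eq_zero fun p _ => ?_
  rw [Finset.prod_eq_zero (Finset.mem_univ j), mul_zero]
  exact ramp_eq_zero (by simp [hj])

theorem sum_ramp_equiv (t : I) : ∑ r, ramp n (e r) t = n * (t : ℝ) := by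
  rw [e.sum_comp fun i : Fin n => ramp n i t, sum_ramp]

variable [DecidableEq ι]

/-- The density, up to the factor `n`, of `gridFun e m` in the variable `j` on the piece `r`. -/
noncomputable def gridSlice (j : Fin d) (r : ι) (u : Fin d → I) : ℝ :=
  ∑ p, m p * ∏ k, if k = j then (if p k = r then 1 else 0) else ramp n (e (p k)) (u k)

/-- Along one variable the function is piecewise linear, with slope `n` times `gridSlice` on each
piece. This reduces monotonicity, the Lipschitz condition and the margins to statements about
slices. -/
theorem gridFun_update (j : Fin d) (u : Fin d → I) (s : I) :
    gridFun e m (Function.update u j s) = ∑ r, ramp n (e r) s * gridSlice e m j r u := by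
  simp only [gridFun, gridSlice, Finset.mul_sum]
  rw [Finset.sum_comm]
  refine Finset.sum_congr rfl fun p _ => ?_
  rw [Finset.sum_eq_single (p j)]
  · rw [← Finset.mul_prod_erase _ _ (Finset.mem_univ j),
      ← Finset.mul_prod_erase Finset.univ _ (Finset.mem_univ j)]
    simp only [Function.update_self, if_true, one_mul]
    rw [mul_left_comm]
    congr 2
    refine Finset.prod_congr rfl fun k hk => ?_
    have hk' := Finset.ne_of_mem_erase hk
    simp [hk']
  · intro r _ hr
    rw [Finset.prod_eq_zero (Finset.mem_univ j), mul_zero, mul_zero]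
    simp [hr.symm]
  · simp

theorem isQuasiCopula_gridFun (hd : 0 < d) (hn : 0 < n)
    (hslice : ∀ j r u, gridSlice e m j r u ∈ Set.Icc (0 : ℝ) (1 / n))
    (hmargin : ∀ j r, gridSlice e m j r (fun _ => 1) = 1 / n) : IsQuasiCopula (gridFun e m) := by
  have hinv : ∀ t : ℝ, n * t * (1 / n) = t := fun t => by field_simp
  have hmono : ∀ (j : Fin d) (u : Fin d → I), Monotone fun t : I =>
      gridFun e m (Function.update u j t) := by
    intro j u s t hst
    simp only [gridFun_update]
    exact Finset.sum_le_sum fun r _ =>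
      mul_le_mul_of_nonneg_right (ramp_mono _ _ hst) (hslice j r u).1
  have hlip : ∀ (j : Fin d) (u : Fin d → I) (s t : I), s ≤ t →
      gridFun e m (Function.update u j t) - gridFun e m (Function.update u j s) ≤ t - s := by
    intro j u s t hst
    rw [gridFun_update, gridFun_update, ← Finset.sum_sub_distrib]
    calc ∑ r, (ramp n (e r) t * gridSlice e m j r u - ramp n (e r) s * gridSlice e m j r u)
        ≤ ∑ r, (ramp n (e r) t - ramp n (e r) s) * (1 / n) := by
          refine Finset.sum_le_sum fun r _ => ?_
          rw [← sub_mul]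
          exact mul_le_mul_of_nonneg_left (hslice j r u).2
            (sub_nonneg.mpr (ramp_mono _ _ hst))
      _ = n * (t - s : ℝ) * (1 / n) := by
          rw [← Finset.sum_mul, Finset.sum_sub_distrib, sum_ramp_equiv, sum_ramp_equiv, mul_sub]
      _ ≤ t - s := by
          rw [hinv]
  refine ⟨fun u => ?_, ?_, hmono, ?_⟩
  · have h0 := gridFun_of_eq_zero e m (Function.update u ⟨0, hd⟩ 0) ⟨0, hd⟩ (by simp)
    have h1 := hmono ⟨0, hd⟩ u (unitInterval.nonneg' : 0 ≤ u ⟨0, hd⟩)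
    have h2 := hlip ⟨0, hd⟩ u 0 (u ⟨0, hd⟩) unitInterval.nonneg'
    simp only [Function.update_eq_self, h0] at h1 h2
    refine ⟨h1, ?_⟩
    have := (u ⟨0, hd⟩).2.2
    simp at h2
    linarith
  · intro j t
    rw [gridFun_update, Finset.sum_congr rfl fun r _ => by rw [hmargin j r], ← Finset.sum_mul,
      sum_ramp_equiv, hinv]
  · intro j u s t
    have key : ∀ s t : I, s ≤ t → |gridFun e m (Function.update u j t) -
        gridFun e m (Function.update u j s)| ≤ |(t : ℝ) - s| := fun s t h => by
      have h' : (s : ℝ) ≤ t := h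
      have h2 := hmono j u h
      rw [abs_of_nonneg (sub_nonneg.mpr h2), abs_of_nonneg (sub_nonneg.mpr h')]
      exact hlip j u s t h
    rcases le_total s t with h | h
    · rw [abs_sub_comm, abs_sub_comm (s : ℝ)]
      exact key s t h
    · exact key t s h

end gridFun

/-! ### Shuffles of functions with piecewise constant density -/

section shuffle

variable {n : ℕ}

/-- The point `x / n` of the unit interval. -/
noncomputable def gridPoint (n : ℕ) (x : ℝ) (h0 : 0 ≤ x) (h1 : x ≤ n) : I :=
  ⟨x / n, div_nonneg h0 n.cast_nonneg, div_le_one_of_le₀ h1 n.cast_nonneg⟩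

theorem mul_gridPoint (hn : 0 < n) (x : ℝ) (h0 : 0 ≤ x) (h1 : x ≤ n) :
    n * (gridPoint n x h0 h1 : ℝ) = x := by
  simp only [gridPoint]
  field_simp

theorem Fin.val_add_one_le_cast (i : Fin n) : (i : ℝ) + 1 ≤ n := by
  exact_mod_cast i.2

theorem exists_piece (hn : 0 < n) (t : I) (ht : 0 < t) :
    ∃ i : Fin n, (i : ℝ) < n * t ∧ n * (t : ℝ) ≤ i + 1 := by
  have ht' : (0 : ℝ) < t := ht
  have hpos : 0 < n * (t : ℝ) := by positivity
  have hc : 0 < ⌈n * (t : ℝ)⌉₊ := Nat.ceil_pos.mpr hpos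
  have hle : ⌈n * (t : ℝ)⌉₊ ≤ n :=
    Nat.ceil_le.mpr (mul_le_of_le_one_right n.cast_nonneg t.2.2)
  -- Ceiling minus one rather than floor, since the pieces are closed on the right.
  refine ⟨⟨⌈n * (t : ℝ)⌉₊ - 1, by omega⟩, Nat.lt_ceil.mp ?_, ?_⟩
  · simp only
    omega
  · have h := Nat.le_ceil (n * (t : ℝ))
    have h2 : ((⌈n * (t : ℝ)⌉₊ - 1 : ℕ) : ℝ) + 1 = ⌈n * (t : ℝ)⌉₊ := by
      exact_mod_cast Nat.sub_add_cancel hc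
    simpa only [h2] using h

theorem piece_unique {i j : Fin n} {x : ℝ} (hi : (i : ℝ) < x) (hi' : x ≤ i + 1) (hj : (j : ℝ) < x)
    (hj' : x ≤ j + 1) : i = j := by
  have h1 : (i : ℝ) < (j : ℝ) + 1 := by linarith
  have h2 : (j : ℝ) < (i : ℝ) + 1 := by linarith
  have h3 : (i : ℕ) < j + 1 := by exact_mod_cast h1
  have h4 : (j : ℕ) < i + 1 := by exact_mod_cast h2
  exact Fin.ext (by omega)

theorem card_filter_perm_lt (π : Equiv.Perm (Fin n)) (i : Fin n) :
    (Finset.univ.filter fun j => π j < π i).card = π i := by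
  have h : (Finset.univ.filter fun j => π j < π i).map π.toEmbedding = Finset.Iio (π i) := by
    ext j
    simp only [Finset.mem_map_equiv, Finset.mem_filter, Finset.mem_univ, true_and,
      Equiv.apply_symm_apply, Finset.mem_Iio]
  rw [← Finset.card_map π.toEmbedding, h, Fin.card_Iio]

/-- Every permutation of pieces of equal length is realized by a slice map. -/
theorem exists_isSliceMap (hn : 0 < n) (π : Equiv.Perm (Fin n)) :
    ∃ (a : Fin (n + 1) → I) (φ : I → I), IsSliceMap a π φ ∧ φ 0 = 0 ∧
      ∀ (i : Fin n) (t : I), (i : ℝ) < n * t → n * (t : ℝ) ≤ i + 1 →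
        n * (φ t : ℝ) = n * t - i + π i := by
  have hn' : (0 : ℝ) < n := by exact_mod_cast hn
  -- The point `0` lies in no piece, so its image is prescribed separately.
  have hex : ∀ t : I, ∃ y : I, (t = 0 → y = 0) ∧
      ∀ i : Fin n, (i : ℝ) < n * t → n * (t : ℝ) ≤ i + 1 → n * (y : ℝ) = n * t - i + π i := by
    intro t
    rcases eq_or_lt_of_le (unitInterval.nonneg' : 0 ≤ t) with h | h
    · refine ⟨0, fun _ => rfl, fun i hi _ => ?_⟩
      rw [← h] at hi
      simp only [Set.Icc.coe_zero, mul_zero] at hi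
      exact absurd hi (not_lt.mpr (Nat.cast_nonneg _))
    · obtain ⟨i, hi, hi'⟩ := exists_piece hn t h
      have h2 := Fin.val_add_one_le_cast (π i)
      have h3 : (0 : ℝ) ≤ (π i : ℕ) := Nat.cast_nonneg _
      refine ⟨gridPoint n (n * t - i + π i) (by linarith) (by linarith),
        fun h0 => absurd h0 h.ne', fun j hj hj' => ?_⟩
      rw [mul_gridPoint hn, piece_unique hi hi' hj hj']
  choose φ hφ0 hφ using hex
  have hval : ∀ j : Fin (n + 1), (j : ℝ) ≤ n := fun j => by
    exact_mod_cast Nat.lt_succ_iff.mp j.2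
  refine ⟨fun j => gridPoint n j (Nat.cast_nonneg _) (hval j), φ, ?_, hφ0 0 rfl, fun i t => hφ t i⟩
  refine ⟨fun i j hij => ?_, ?_, ?_, hφ0 0 rfl, fun i t hi hi' => ?_⟩
  · have : (i : ℝ) ≤ j := by exact_mod_cast hij
    exact Subtype.coe_le_coe.mp (div_le_div_of_nonneg_right this hn'.le)
  · exact Subtype.ext (by simp [gridPoint])
  · exact Subtype.ext (by simp [gridPoint, hn'.ne'])
  · have h1 : (i : ℝ) / n < t := hi
    have h2 : (t : ℝ) ≤ ((i : ℕ) + 1 : ℕ) / n := hi'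
    rw [div_lt_iff₀' hn'] at h1
    rw [le_div_iff₀' hn'] at h2
    have h3 := hφ t i h1 (by exact_mod_cast h2)
    have h4 : ∀ j : Fin n, ((gridPoint n (j.succ : Fin (n + 1)) (Nat.cast_nonneg _) (hval _) : I) : ℝ)
        - (gridPoint n (j.castSucc : Fin (n + 1)) (Nat.cast_nonneg _) (hval _) : I) = 1 / n := by
      intro j
      simp only [gridPoint, Fin.val_succ, Fin.val_castSucc]
      push_cast
      ring
    rw [Finset.sum_congr rfl fun j _ => h4 j, Finset.sum_const, card_filter_perm_lt]
    simp only [gridPoint, Fin.val_castSucc, nsmul_eq_mul]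
    field_simp
    linarith

/-- The slice map translates the piece numbered `e₂ r` onto the piece numbered `e₁ r`. It thus
carries uniform mass on cells to uniform mass on cells, and only the numbering changes. -/
theorem isShuffle_gridFun {d : ℕ} {ι : Type*} [Fintype ι] (hn : 0 < n) (e₁ e₂ : ι ≃ Fin n)
    (m : (Fin d → ι) → ℝ) (hQ : IsQuasiCopula (gridFun e₂ m)) :
    IsShuffle (gridFun e₁ m) (gridFun e₂ m) := by
  set π : Equiv.Perm (Fin n) := e₂.symm.trans e₁ with hπ
  obtain ⟨a, φ, hφ, hφ0, hφ'⟩ := exists_isSliceMap hn π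
  refine ⟨fun _ => n, fun _ => a, fun _ => π, fun _ => φ, fun _ => hφ, fun u => ?_⟩
  symm
  have hn' : (0 : ℝ) < n := by exact_mod_cast hn
  have hx0 : ∀ i : Fin n, (i : ℝ) ≤ n := fun i => by linarith [Fin.val_add_one_le_cast i]
  let x : Fin n → I := fun i => gridPoint n i (Nat.cast_nonneg _) (hx0 i)
  -- The part of piece `i` that is mapped into `(0, t]` is an initial segment of relative length
  -- `ramp n (π i) t`.
  let y : Fin n → I → I := fun i t => gridPoint n (i + ramp n (π i) t)
    (add_nonneg (Nat.cast_nonneg _) (ramp_nonneg _ _ _))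
    (by linarith [Fin.val_add_one_le_cast i, ramp_le_one n (π i) t])
  have hxn : ∀ i, n * (x i : ℝ) = i := fun i => mul_gridPoint hn _ _ _
  have hyn : ∀ i t, n * (y i t : ℝ) = i + ramp n (π i) t := fun i t => mul_gridPoint hn _ _ _
  have hle : ∀ s t : I, s ≤ t ↔ n * (s : ℝ) ≤ n * t := fun s t => by
    rw [mul_le_mul_iff_right₀ hn']; rfl
  have hlt : ∀ s t : I, s < t ↔ n * (s : ℝ) < n * t := fun s t => by
    rw [mul_lt_mul_iff_right₀ hn']; rfl
  have hpiece : ∀ (i : Fin n) (s t : I), x i < t ∧ t ≤ y i s →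
      (i : ℝ) < n * t ∧ n * (t : ℝ) ≤ i + 1 := by
    intro i s t h
    rw [hlt, hle, hxn, hyn] at h
    exact ⟨h.1, by linarith [ramp_le_one n (π i) s]⟩
  apply hQ.inducedMeasure_eq
  refine ⟨Fin d → Fin n, inferInstance, fun c k => x (c k), fun c k => y (c k) (u k),
    ?_, ?_, ?_, ?_⟩
  · intro c k
    rw [hle, hxn, hyn]
    linarith [ramp_nonneg n (π (c k)) (u k)]
  · intro c c' hcc
    rw [Set.disjoint_left]
    intro t ht ht'
    refine hcc (funext fun k => ?_)
    have h1 := hpiece _ _ _ (ht k)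
    have h2 := hpiece _ _ _ (ht' k)
    exact piece_unique h1.1 h1.2 h2.1 h2.2
  · have hone : ∀ (i : Fin n) (s t : I), (i : ℝ) < n * t → n * (t : ℝ) ≤ i + 1 →
        ((0 < φ t ∧ φ t ≤ s) ↔ (x i < t ∧ t ≤ y i s)) := by
      intro i s t h1 h2
      have h3 := hφ' i t h1 h2
      have h0 : (0 : ℝ) ≤ (π i : ℕ) := Nat.cast_nonneg _
      rw [hlt, hle, hlt, hle, h3, hxn, hyn]
      simp only [Set.Icc.coe_zero, mul_zero]
      constructor
      · rintro ⟨-, h5⟩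
        refine ⟨h1, ?_⟩
        have : n * (t : ℝ) - i ≤ ramp n (π i) s :=
          le_max_of_le_right (le_min (by linarith) (by linarith))
        linarith
      · rintro ⟨-, h5⟩
        refine ⟨by linarith, ?_⟩
        have h6 : 0 < ramp n (π i) s := by linarith
        have h7 : ramp n (π i) s ≤ n * s - π i := by
          unfold ramp at h6 ⊢
          rcases lt_max_iff.mp h6 with h | h
          · exact absurd h (lt_irrefl _)
          · rw [max_eq_right h.le]
            exact min_le_right _ _
        linarith
    ext t
    simp only [Set.mem_preimage, halfOpenBox, Set.mem_ofPred_eq, Set.mem_iUnion]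
    constructor
    · intro h
      have hpos : ∀ k, 0 < t k := fun k => by
        rcases eq_or_lt_of_le (unitInterval.nonneg' : 0 ≤ t k) with h' | h'
        · have := (h k).1
          rw [← h', hφ0] at this
          exact absurd this (lt_irrefl _)
        · exact h'
      choose c hc hc' using fun k => exists_piece hn (t k) (hpos k)
      exact ⟨c, fun k => (hone (c k) (u k) (t k) (hc k) (hc' k)).mp (h k)⟩
    · rintro ⟨c, hc⟩ k
      have := hpiece _ _ _ (hc k)
      exact (hone (c k) (u k) (t k) this.1 this.2).mpr (hc k)
  -- The segment from `x c` to `y c t` stays inside piece `c`, so it meets only the mass spread over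
  -- that piece.
  · have hdiff : ∀ (i c : Fin n) (t : I),
        ramp n i (y c t) - ramp n i (x c) = if c = i then ramp n (π c) t else 0 := by
      intro i c t
      have h0 := ramp_nonneg n (π c) t
      have h1 := ramp_le_one n (π c) t
      rcases lt_trichotomy c i with h | h | h
      · have h' : (c : ℝ) + 1 ≤ i := by exact_mod_cast h
        rw [if_neg h.ne, ramp_eq_zero (by rw [hyn]; linarith),
          ramp_eq_zero (by rw [hxn]; linarith), sub_zero]
      · subst h
        rw [if_pos rfl, ramp_of_mem (hyn c t) h0 h1, ramp_eq_zero (hxn c).le, sub_zero]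
      · have h' : (i : ℝ) + 1 ≤ c := by exact_mod_cast h
        rw [if_neg h.ne', ramp_eq_one (by rw [hyn]; linarith),
          ramp_eq_one (by rw [hxn]; linarith), sub_self]
    have hvol : ∀ X Y : Fin d → I, boxVolume (gridFun e₂ m) X Y =
        ∑ p, m p * ∏ k, (ramp n (e₂ (p k)) (Y k) - ramp n (e₂ (p k)) (X k)) := by
      intro X Y
      refine (boxVolume_sum m (fun p v => ∏ k, ramp n (e₂ (p k)) (v k)) X Y).trans ?_
      exact Finset.sum_congr rfl fun p _ => by
        rw [boxVolume_prod fun k s => ramp n (e₂ (p k)) s]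
    simp only [hvol, hdiff]
    rw [Finset.sum_comm]
    refine Finset.sum_congr rfl fun p _ => ?_
    rw [← Finset.mul_sum,
      sum_prod_apply fun k c => if c = e₂ (p k) then ramp n (π c) (u k) else 0]
    congr 1
    refine Finset.prod_congr rfl fun k _ => ?_
    simp [hπ]

end shuffle

/-! ### Cell masses of a quasi-copula -/

/-- The distribution functions of the slices of the signed weight `q` on the grid take values in
`[0, 1/N]`, also when the indicators of initial segments are replaced by their convex
combinations, and every slice has total mass `1/N`. -/
structure IsSliceBounded {d N : ℕ} (q : (Fin d → Fin N) → ℝ) : Prop where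
  mem_Icc : ∀ (j : Fin d) (r : Fin N) (η : Fin d → Fin N → ℝ),
    (∀ i, η j i = if i = r then 1 else 0) →
    (∀ k, k ≠ j → Antitone (η k) ∧ ∀ i, η k i ∈ Set.Icc (0 : ℝ) 1) →
    ∑ i, q i * ∏ k, η k (i k) ∈ Set.Icc (0 : ℝ) (1 / N)
  sum_slice : ∀ (j : Fin d) (r : Fin N), ∑ i, q i * (if i j = r then 1 else 0) = 1 / N

/-- The coefficient of `F c` in the increment `F i - F (i - 1)`. -/
def incrCoeff {N : ℕ} (c i : Fin N) : ℝ :=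
  (if c = i then 1 else 0) - (if (c : ℕ) + 1 = i then 1 else 0)

/-! ### Summation by parts in one variable -/

section incrCoeff

variable {N : ℕ}

theorem sum_incrCoeff_mul (η : Fin N → ℝ) (c : Fin N) :
    ∑ i, incrCoeff c i * η i = η c - if h : (c : ℕ) + 1 < N then η ⟨c + 1, h⟩ else 0 := by
  simp only [incrCoeff, sub_mul, Finset.sum_sub_distrib, ite_mul, one_mul, zero_mul,
    Finset.sum_ite_eq, Finset.mem_univ, if_true]
  congr 1
  split_ifs with h
  · rw [Finset.sum_eq_single ⟨c + 1, h⟩]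
    · simp
    · intro i _ hi
      rw [if_neg]
      intro h'
      exact hi (Fin.ext h'.symm)
    · simp
  · refine Finset.sum_eq_zero fun i _ => if_neg ?_
    have := i.2
    omega

theorem sum_incrCoeff_mul_nonneg {η : Fin N → ℝ} (hη : Antitone η) (h0 : ∀ i, 0 ≤ η i)
    (c : Fin N) : 0 ≤ ∑ i, incrCoeff c i * η i := by
  rw [sum_incrCoeff_mul]
  split_ifs with h
  · exact sub_nonneg.mpr (hη (Fin.mk_le_mk.mpr (Nat.le_succ _)))
  · simpa using h0 c

/-- The index `c` stands for the grid point `c + 1`; the hypothesis `G 0 = 0` supplies the missing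
lowest point. -/
theorem sum_incrCoeff_left_mul (G : ℕ → ℝ) (h0 : G 0 = 0) (r : Fin N) :
    ∑ c : Fin N, incrCoeff c r * G (c + 1) = G (r + 1) - G r := by
  simp only [incrCoeff, sub_mul, Finset.sum_sub_distrib, ite_mul, one_mul, zero_mul,
    Finset.sum_ite_eq', Finset.mem_univ, if_true]
  congr 1
  obtain ⟨r, hr⟩ := r
  cases r with
  | zero => simp [h0]
  | succ r =>
    rw [Finset.sum_eq_single ⟨r, by omega⟩]
    · simp
    · intro i _ hi
      rw [if_neg]
      intro h'
      exact hi (Fin.ext (by simpa using h'))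
    · simp

theorem sum_sum_incrCoeff_mul (hN : 0 < N) (η : Fin N → ℝ) :
    ∑ c, ∑ i, incrCoeff c i * η i = η ⟨0, hN⟩ := by
  rw [Finset.sum_comm]
  have h : ∀ i : Fin N, ∑ c, incrCoeff c i * η i = if i = ⟨0, hN⟩ then η i else 0 := by
    intro i
    have := sum_incrCoeff_left_mul (fun x => if x = 0 then 0 else η i) rfl i
    simp only [Nat.add_eq_zero_iff, one_ne_zero, and_false, if_false] at this
    rw [this]
    by_cases hi : i = ⟨0, hN⟩
    · simp [hi]
    · have : (i : ℕ) ≠ 0 := fun h => hi (Fin.ext h)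
      simp [hi, this]
  simp [h]

end incrCoeff

/-! ### Cell masses as mixed differences, and summation by parts in all variables -/

section cellMass

variable {d N : ℕ}

/-- The upper corner of the cell with index `c`. -/
noncomputable def upperCorner (c : Fin d → Fin N) : Fin d → I := fun k =>
  gridPoint N ((c k : ℕ) + 1) (by positivity) (Fin.val_add_one_le_cast _)

/-- The mass that a grounded function `Q` gives to the cells of the grid. -/
noncomputable def cellMass (N : ℕ) (Q : (Fin d → I) → ℝ) (i : Fin d → Fin N) : ℝ :=
  ∑ c, Q (upperCorner c) * ∏ k, incrCoeff (c k) (i k)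

/-- Abel summation: differences are moved from `Q` to the test functions. For decreasing nonnegative
`η k` the new coefficients are nonnegative, by `sum_incrCoeff_mul_nonneg`. -/
theorem sum_cellMass_mul_prod (Q : (Fin d → I) → ℝ) (η : Fin d → Fin N → ℝ) :
    ∑ i, cellMass N Q i * ∏ k, η k (i k) =
      ∑ c : Fin d → Fin N, Q (upperCorner c) * ∏ k, ∑ a, incrCoeff (c k) a * η k a := by
  simp only [cellMass, Finset.sum_mul]
  rw [Finset.sum_comm]
  refine Finset.sum_congr rfl fun c _ => ?_
  rw [← sum_prod_apply fun k a => incrCoeff (c k) a * η k a, Finset.mul_sum]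
  exact Finset.sum_congr rfl fun i _ => by rw [Finset.prod_mul_distrib, mul_assoc]

theorem sum_cellMass_le (Q : (Fin d → I) → ℝ) (b : Fin d → Fin N) :
    ∑ i, cellMass N Q i * ∏ k, (if i k ≤ b k then (1 : ℝ) else 0) = Q (upperCorner b) := by
  rw [sum_cellMass_mul_prod Q fun k a => if a ≤ b k then 1 else 0]
  have h : ∀ c k : Fin N, ∑ a, incrCoeff c a * (if a ≤ k then (1 : ℝ) else 0) =
      if c = k then 1 else 0 := by
    intro c k
    rw [sum_incrCoeff_mul]
    rcases lt_trichotomy c k with h | h | h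
    · have h1 : (c : ℕ) < k := h
      have h2 : (c : ℕ) + 1 < N := by have := k.2; omega
      rw [dif_pos h2, if_pos h.le, if_pos (Fin.mk_le_of_le_val h1), if_neg h.ne, sub_self]
    · subst h
      simp [Fin.le_def]
    · have h1 : (k : ℕ) < c := h
      rw [if_neg (not_le.mpr h), if_neg h.ne']
      split_ifs with h2 h3
      · have h4 : (c : ℕ) + 1 ≤ k := h3
        omega
      · simp
      · simp
  simp only [h]
  rw [Finset.sum_eq_single b]
  · simp
  · intro c _ hc
    obtain ⟨k, hk⟩ := Function.ne_iff.mp hc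
    rw [Finset.prod_eq_zero (Finset.mem_univ k) (if_neg hk), mul_zero]
  · simp

theorem sum_incrCoeff_mul_update (hN : 0 < N) {Q : (Fin d → I) → ℝ} (hQ : IsQuasiCopula Q)
    (u : Fin d → I) (j : Fin d) (r : Fin N) (y : Fin N → I) (hy : ∀ x, N * (y x : ℝ) = x + 1) :
    ∃ s t : I, (t : ℝ) - s = 1 / N ∧ s ≤ t ∧ ∑ x, incrCoeff x r * Q (Function.update u j (y x)) =
      Q (Function.update u j t) - Q (Function.update u j s) := by
  have hN' : (0 : ℝ) < N := by exact_mod_cast hN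
  -- Projecting to the interval makes the grid points available for all natural numbers, including
  -- the index `0`, where `Q` vanishes.
  let p : ℕ → I := fun x => Set.projIcc 0 1 zero_le_one (x / N : ℝ)
  have hp : ∀ x : ℕ, x ≤ N → (p x : ℝ) = x / N := fun x hx => by
    refine congrArg Subtype.val (Set.projIcc_of_mem zero_le_one ?_)
    exact ⟨by positivity, div_le_one_of_le₀ (by exact_mod_cast hx) hN'.le⟩
  have hyp : ∀ x : Fin N, y x = p (x + 1) := fun x => Subtype.ext (by
    rw [hp _ x.2]
    push_cast
    rw [eq_div_iff hN'.ne', mul_comm, hy])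
  have h1 := hp _ r.2
  have h2 := hp _ r.2.le
  have hd : (p (r + 1) : ℝ) - p r = 1 / N := by
    have : (p (r + 1) : ℝ) = (r + 1 : ℕ) / N := h1
    rw [this, h2]
    push_cast
    ring
  refine ⟨p r, p (r + 1), hd, ?_, ?_⟩
  · have : 0 < 1 / (N : ℝ) := by positivity
    exact Subtype.coe_le_coe.mp (by linarith)
  · simp only [hyp]
    refine sum_incrCoeff_left_mul (fun x => Q (Function.update u j (p x))) ?_ r
    refine hQ.grounded _ j ?_
    simp only [Function.update_self]
    exact Subtype.ext (by rw [hp 0 (Nat.zero_le _)]; simp)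

theorem sum_univ_insertNth {d : ℕ} {α : Type*} [Fintype α] (j : Fin (d + 1))
    (F : (Fin (d + 1) → α) → ℝ) :
    ∑ c, F c = ∑ c' : Fin d → α, ∑ x, F (j.insertNth x c') := by
  rw [Finset.sum_comm, ← Fintype.sum_prod_type', ← (Fin.insertNthEquiv (fun _ => α) j).sum_comp]
  rfl

theorem sum_mul_prod_insertNth {d : ℕ} {α : Type*} [Fintype α] (j : Fin (d + 1))
    (R : (Fin (d + 1) → α) → ℝ) (w : Fin (d + 1) → α → ℝ) :
    ∑ c, R c * ∏ k, w k (c k) = ∑ c' : Fin d → α,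
      (∑ x, w j x * R (j.insertNth x c')) * ∏ k, w (j.succAbove k) (c' k) := by
  rw [sum_univ_insertNth j]
  refine Finset.sum_congr rfl fun c' _ => ?_
  rw [Finset.sum_mul]
  refine Finset.sum_congr rfl fun x _ => ?_
  rw [Fin.prod_univ_succAbove _ j]
  simp only [Fin.insertNth_apply_same, Fin.insertNth_apply_succAbove]
  ring

/-- After summation by parts in the variables other than `j`, the sum is a combination of increments
of `Q` over a step `1 / N` in direction `j`. Each increment lies in `[0, 1 / N]`, and the
coefficients are nonnegative with sum the product of the largest values of the `η k`, hence at most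
`1`. -/
theorem isSliceBounded_cellMass {Q : (Fin d → I) → ℝ} (hQ : IsQuasiCopula Q) :
    IsSliceBounded (cellMass N Q) := by
  cases d with
  | zero => exact ⟨fun j => j.elim0, fun j => j.elim0⟩
  | succ d =>
  have hy : ∀ x : Fin N, 0 < N → N * (gridPoint N ((x : ℕ) + 1) (by positivity)
      (Fin.val_add_one_le_cast _) : ℝ) = x + 1 := fun x hN => mul_gridPoint hN _ _ _
  have hcorner : ∀ (j : Fin (d + 1)) (x r : Fin N) (c : Fin d → Fin N),
      upperCorner (j.insertNth x c : Fin (d + 1) → Fin N) =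
        Function.update (upperCorner (j.insertNth r c : Fin (d + 1) → Fin N)) j
          (gridPoint N ((x : ℕ) + 1) (by positivity) (Fin.val_add_one_le_cast _)) := by
    intro j x r c
    funext k
    rcases Fin.eq_self_or_eq_succAbove j k with rfl | ⟨k, rfl⟩
    · simp [upperCorner]
    · simp [upperCorner]
  have hw : ∀ (r x : Fin N), ∑ a, incrCoeff x a * (if a = r then (1 : ℝ) else 0) = incrCoeff x r :=
    fun r x => by simp
  have hincr : ∀ (j : Fin (d + 1)) (r : Fin N) (c : Fin d → Fin N),
      ∃ s t : I, (t : ℝ) - s = 1 / N ∧ s ≤ t ∧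
        ∑ x, incrCoeff x r * Q (upperCorner (j.insertNth x c)) =
          Q (Function.update (upperCorner (j.insertNth r c : Fin (d + 1) → Fin N)) j t) -
            Q (Function.update (upperCorner (j.insertNth r c : Fin (d + 1) → Fin N)) j s) := by
    intro j r c
    obtain ⟨s, t, hst, hle, h⟩ := sum_incrCoeff_mul_update r.pos hQ
      (upperCorner (j.insertNth r c : Fin (d + 1) → Fin N)) j r _ fun x => hy x r.pos
    refine ⟨s, t, hst, hle, (Finset.sum_congr rfl fun x _ => ?_).trans h⟩
    rw [hcorner j x r c]
  refine ⟨fun j r η hj hη => ?_, fun j r => ?_⟩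
  · have hN : 0 < N := r.pos
    rw [sum_cellMass_mul_prod, sum_mul_prod_insertNth j (fun c => Q (upperCorner c))
      fun k x => ∑ a, incrCoeff x a * η k a]
    simp only [hj, hw]
    have hD : ∀ c' : Fin d → Fin N, ∑ x, incrCoeff x r * Q (upperCorner (j.insertNth x c')) ∈
        Set.Icc (0 : ℝ) (1 / N) := by
      intro c'
      obtain ⟨s, t, hst, hle, h⟩ := hincr j r c'
      rw [h]
      have h1 := hQ.lipschitz j (upperCorner (j.insertNth r c' : Fin (d + 1) → Fin N)) t s
      rw [hst, abs_of_nonneg (by positivity : (0 : ℝ) ≤ 1 / N)] at h1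
      exact ⟨sub_nonneg.mpr (hQ.monotone j _ hle), (le_abs_self _).trans h1⟩
    have hW : ∀ c' : Fin d → Fin N,
        0 ≤ ∏ k, ∑ a, incrCoeff (c' k) a * η (j.succAbove k) a := fun c' =>
      Finset.prod_nonneg fun k _ => sum_incrCoeff_mul_nonneg (hη _ (Fin.succAbove_ne j k)).1
        (fun i => ((hη _ (Fin.succAbove_ne j k)).2 i).1) _
    refine ⟨Finset.sum_nonneg fun c' _ => mul_nonneg (hD c').1 (hW c'), ?_⟩
    refine (Finset.sum_le_sum fun c' _ => mul_le_mul_of_nonneg_right (hD c').2 (hW c')).trans ?_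
    rw [← Finset.mul_sum,
      sum_prod_apply fun (k : Fin d) x => ∑ a, incrCoeff x a * η (j.succAbove k) a]
    simp only [sum_sum_incrCoeff_mul hN]
    refine mul_le_of_le_one_right (by positivity) (Finset.prod_le_one (fun k _ => ?_) fun k _ => ?_)
    · exact ((hη _ (Fin.succAbove_ne j k)).2 _).1
    · exact ((hη _ (Fin.succAbove_ne j k)).2 _).2
  · have hN : 0 < N := r.pos
    let η : Fin (d + 1) → Fin N → ℝ := fun k a => if k = j then (if a = r then 1 else 0) else 1
    have h1 : ∀ i : Fin (d + 1) → Fin N, (if i j = r then (1 : ℝ) else 0) = ∏ k, η k (i k) := by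
      intro i
      simp [η]
    have h2 : ∀ k a, η (j.succAbove k) a = 1 := fun k a => by simp [η]
    have h3 : ∀ a, η j a = if a = r then 1 else 0 := fun a => by simp [η]
    simp only [h1]
    rw [sum_cellMass_mul_prod, sum_mul_prod_insertNth j (fun c => Q (upperCorner c))
      fun k x => ∑ a, incrCoeff x a * η k a]
    have h4 : ∀ c' : Fin d → Fin N,
        (∑ x, (∑ a, incrCoeff x a * η j a) * Q (upperCorner (j.insertNth x c'))) *
          ∏ k, ∑ a, incrCoeff (c' k) a * η (j.succAbove k) a =
        (1 / N) * ∏ k, ∑ a, incrCoeff (c' k) a * η (j.succAbove k) a := by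
      intro c'
      -- For constant test functions only the top corner keeps a nonzero coefficient, and there the
      -- increment is one of the margin.
      by_cases hc : ∀ k, (c' k : ℕ) + 1 = N
      · congr 1
        simp only [h3, hw]
        obtain ⟨s, t, hst, -, h⟩ := hincr j r c'
        have hup : ∀ t, Function.update (upperCorner (j.insertNth r c' : Fin (d + 1) → Fin N)) j t =
            Function.update (fun _ => 1) j t := by
          intro t
          funext k
          rcases Fin.eq_self_or_eq_succAbove j k with rfl | ⟨k, rfl⟩
          · simp
          · have h5 : ((c' k : ℕ) : ℝ) + 1 = N := by exact_mod_cast hc k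
            have h6 : (N : ℝ) ≠ 0 := by positivity
            simp only [ne_eq, Fin.succAbove_ne, not_false_eq_true, Function.update_of_ne, upperCorner,
              Fin.insertNth_apply_succAbove]
            exact Subtype.ext (by simp [gridPoint, h5, h6])
        rw [h, hup, hup, hQ.margin, hQ.margin, hst]
      · push Not at hc
        obtain ⟨k, hk⟩ := hc
        have h5 : (c' k : ℕ) + 1 < N := lt_of_le_of_ne (c' k).2 hk
        have h6 : ∏ k, ∑ a, incrCoeff (c' k) a * η (j.succAbove k) a = 0 := by
          refine Finset.prod_eq_zero (Finset.mem_univ k) ?_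
          rw [sum_incrCoeff_mul, dif_pos h5, h2, h2, sub_self]
        rw [h6, mul_zero, mul_zero]
    rw [Finset.sum_congr rfl fun c' _ => h4 c', ← Finset.mul_sum,
      sum_prod_apply fun (k : Fin d) x => ∑ a, incrCoeff x a * η (j.succAbove k) a]
    simp only [sum_sum_incrCoeff_mul hN]
    simp only [h2, Finset.prod_const_one, mul_one]

end cellMass

/-! ### Interlacing two weights -/

/-- A weight on pairs of multi-indices with marginals close to `q₁` and `q₂` if the total mass of
`ρ` is close to `1`. -/
noncomputable def interlace {d N : ℕ} (ρ q₁ q₂ : (Fin d → Fin N) → ℝ) (i j : Fin d → Fin N) : ℝ :=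
  1 / N ^ d * (1 / N ^ d - ρ j) + q₁ i * ρ j + ρ i * (q₂ j - 1 / N ^ d)

/-- `ρ` is a nonnegative weight, bounded by a multiple of the uniform weight, that vanishes close
to the boundary of the cube. -/
structure IsInterior {d N : ℕ} (δ : ℝ) (ρ : (Fin d → Fin N) → ℝ) : Prop where
  nonneg : ∀ i, 0 ≤ ρ i
  le : ∀ i, ρ i ≤ (1 - δ) / N ^ d
  support : ∀ i, ρ i ≠ 0 → ∀ k, δ * N ≤ (i k : ℕ) ∧ ((i k : ℕ) : ℝ) + 1 ≤ (1 - δ) * N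

section interlace

variable {d N : ℕ}

theorem sum_uniform_mul_prod (f : Fin d → Fin N → ℝ) :
    ∑ i : Fin d → Fin N, 1 / (N : ℝ) ^ d * ∏ k, f k (i k) = ∏ k, (1 / N * ∑ a, f k a) := by
  rw [← Finset.mul_sum, sum_prod_apply, Finset.prod_mul_distrib, Finset.prod_const,
    Finset.card_univ, Fintype.card_fin, one_div_pow]

theorem isSliceBounded_uniform :
    IsSliceBounded (fun _ : Fin d → Fin N => 1 / (N : ℝ) ^ d) := by
  have hmean : ∀ (η : Fin N → ℝ), 0 < N → (∀ i, η i ∈ Set.Icc (0 : ℝ) 1) →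
      0 ≤ 1 / (N : ℝ) * ∑ a, η a ∧ 1 / (N : ℝ) * ∑ a, η a ≤ 1 := by
    intro η hN hη
    have hN' : (0 : ℝ) < N := by exact_mod_cast hN
    refine ⟨mul_nonneg (by positivity) (Finset.sum_nonneg fun a _ => (hη a).1), ?_⟩
    rw [one_div, inv_mul_le_iff₀ hN']
    exact (Finset.sum_le_sum fun a _ => (hη a).2).trans (by simp)
  refine ⟨fun j r η hj hη => ?_, fun j r => ?_⟩
  · have hN : (0 : ℝ) ≤ 1 / N := by positivity
    rw [sum_uniform_mul_prod, ← Finset.mul_prod_erase _ _ (Finset.mem_univ j)]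
    have h1 : 1 / (N : ℝ) * ∑ a, η j a = 1 / N := by simp [hj]
    rw [h1]
    have h2 : ∀ k ∈ Finset.univ.erase j, 0 ≤ 1 / (N : ℝ) * ∑ a, η k a ∧
        1 / (N : ℝ) * ∑ a, η k a ≤ 1 := fun k hk =>
      hmean _ r.pos (hη k (Finset.ne_of_mem_erase hk)).2
    exact ⟨mul_nonneg hN (Finset.prod_nonneg fun k hk => (h2 k hk).1),
      mul_le_of_le_one_right hN (Finset.prod_le_one (fun k hk => (h2 k hk).1)
        fun k hk => (h2 k hk).2)⟩
  · have hN : (N : ℝ) ≠ 0 := by have := r.pos; positivity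
    have h1 : ∀ i : Fin d → Fin N, (if i j = r then (1 : ℝ) else 0) =
        ∏ k, if k = j then (if i k = r then 1 else 0) else 1 := fun i => by simp
    simp only [h1]
    rw [sum_uniform_mul_prod fun k a => if k = j then (if a = r then 1 else 0) else 1,
      ← Finset.mul_prod_erase _ _ (Finset.mem_univ j), Finset.prod_eq_one]
    · simp
    · intro k hk
      simp [Finset.ne_of_mem_erase hk, hN]

theorem IsSliceBounded.sum_eq_one {q : (Fin d → Fin N) → ℝ} (hq : IsSliceBounded q) (hd : 0 < d)
    (hN : 0 < N) : ∑ i, q i = 1 := by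
  have h : ∀ i : Fin d → Fin N, q i = ∑ r, q i * (if i ⟨0, hd⟩ = r then 1 else 0) := fun i => by
    simp
  rw [Finset.sum_congr rfl fun i _ => h i, Finset.sum_comm,
    Finset.sum_congr rfl fun r _ => hq.sum_slice ⟨0, hd⟩ r]
  have : (N : ℝ) ≠ 0 := by positivity
  simp [this]

/-- When one of the two indices of a kernel is frozen, its slice factor leaves a constant condition
`p`; the sum vanishes if `p` fails. -/
theorem IsSliceBounded.sum_mul_prod_mem {q : (Fin d → Fin N) → ℝ} (hq : IsSliceBounded q)
    (j : Fin d) (r : Fin N) (p : Prop) [Decidable p] (η : Fin d → Fin N → ℝ)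
    (hj : ∀ i, η j i = (if i = r then 1 else 0) * (if p then 1 else 0))
    (hη : ∀ k, k ≠ j → Antitone (η k) ∧ ∀ i, η k i ∈ Set.Icc (0 : ℝ) 1) :
    ∑ i, q i * ∏ k, η k (i k) ∈ Set.Icc (0 : ℝ) (1 / N * (if p then 1 else 0)) := by
  by_cases hp : p
  · simp only [hp, if_true, mul_one] at hj ⊢
    exact hq.mem_Icc j r η hj hη
  · have : ∑ i, q i * ∏ k, η k (i k) = 0 := Finset.sum_eq_zero fun i _ => by
      rw [Finset.prod_eq_zero (Finset.mem_univ j) (by simp [hj, hp]), mul_zero]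
    simp [this, hp]

/-- The weights in the slices of `interlace ρ q₁ q₂` and of products of functions of the indices
that are decreasing in the lexicographic order; `b k` is the only first index for which the
value of `E k` depends on the second one. -/
structure IsLexKernel {d N : ℕ} (j₀ : Fin d) (r s : Fin N) (b : Fin d → ℕ) (U : Fin d → ℝ)
    (E : Fin d → Fin N → Fin N → ℝ) : Prop where
  slice : ∀ i j, E j₀ i j = (if i = r then 1 else 0) * (if j = s then 1 else 0)
  mem_Icc : ∀ k, k ≠ j₀ → ∀ i j, E k i j ∈ Set.Icc (0 : ℝ) 1
  anti_left : ∀ k, k ≠ j₀ → ∀ j, Antitone fun i => E k i j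
  anti_right : ∀ k, k ≠ j₀ → ∀ i, Antitone fun j => E k i j
  eq_one : ∀ k, k ≠ j₀ → ∀ i j : Fin N, (i : ℕ) < b k → E k i j = 1
  eq_zero : ∀ k, k ≠ j₀ → ∀ i j : Fin N, b k < (i : ℕ) → E k i j = 0
  sum_eq : ∀ k, k ≠ j₀ → ∑ i, ∑ j, E k i j = N ^ 2 * U k
  mem_unit : ∀ k, U k ∈ Set.Icc (0 : ℝ) 1
  floor : ∀ k, (b k : ℝ) ≤ N * U k ∧ N * U k ≤ b k + 1

/-! ### Bounds for the slices of the interlaced weight -/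

namespace IsLexKernel

variable {j₀ : Fin d} {r s : Fin N} {b : Fin d → ℕ} {U : Fin d → ℝ}
  {E : Fin d → Fin N → Fin N → ℝ}

theorem prod_mem_Icc (hE : IsLexKernel j₀ r s b U E) (i j : Fin d → Fin N) : ∏ k, E k (i k) (j k) ∈
    Set.Icc (0 : ℝ) ((if i j₀ = r then 1 else 0) * (if j j₀ = s then 1 else 0)) := by
  rw [← Finset.mul_prod_erase _ _ (Finset.mem_univ j₀), hE.slice]
  have h0 : (0 : ℝ) ≤ (if i j₀ = r then 1 else 0) * (if j j₀ = s then 1 else 0) := by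
    split_ifs <;> simp
  have h : ∀ k ∈ Finset.univ.erase j₀, E k (i k) (j k) ∈ Set.Icc (0 : ℝ) 1 := fun k hk =>
    hE.mem_Icc k (Finset.ne_of_mem_erase hk) _ _
  exact ⟨mul_nonneg h0 (Finset.prod_nonneg fun k hk => (h k hk).1),
    mul_le_of_le_one_right h0 (Finset.prod_le_one (fun k hk => (h k hk).1) fun k hk => (h k hk).2)⟩

theorem sum_sum_uniform (hE : IsLexKernel j₀ r s b U E) : ∑ i : Fin d → Fin N, ∑ j : Fin d → Fin N,
    1 / (N : ℝ) ^ d * (1 / N ^ d * ∏ k, E k (i k) (j k)) =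
      1 / N ^ 2 * ∏ k ∈ Finset.univ.erase j₀, U k := by
  have hN : (N : ℝ) ≠ 0 := by have := r.pos; positivity
  have h1 : ∀ k ∈ Finset.univ.erase j₀, ∑ i, ∑ j, E k i j = N ^ 2 * U k := fun k hk =>
    hE.sum_eq k (Finset.ne_of_mem_erase hk)
  have h2 : ∑ i, ∑ j, E j₀ i j = 1 := by simp [hE.slice]
  have h3 : (N : ℝ) ^ d = N * N ^ (Finset.univ.erase j₀).card := by
    rw [← pow_succ', Finset.card_erase_add_one (Finset.mem_univ _), Finset.card_univ,
      Fintype.card_fin]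
  simp only [← Finset.mul_sum]
  rw [sum_sum_prod_apply, ← Finset.mul_prod_erase _ _ (Finset.mem_univ j₀), h2,
    Finset.prod_congr rfl h1, Finset.prod_mul_distrib, Finset.prod_const, h3]
  field_simp
  ring

theorem sum_right_mem (hE : IsLexKernel j₀ r s b U E)
    {q : (Fin d → Fin N) → ℝ} (hq : IsSliceBounded q) (i : Fin d → Fin N) :
    ∑ j, q j * ∏ k, E k (i k) (j k) ∈ Set.Icc (0 : ℝ) (1 / N * (if i j₀ = r then 1 else 0)) :=
  hq.sum_mul_prod_mem j₀ s (i j₀ = r) (fun k a => E k (i k) a)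
    (fun a => by rw [hE.slice, mul_comm])
    fun k hk => ⟨hE.anti_right k hk _, fun _ => hE.mem_Icc k hk _ _⟩

theorem sum_left_mem (hE : IsLexKernel j₀ r s b U E)
    {q : (Fin d → Fin N) → ℝ} (hq : IsSliceBounded q) (j : Fin d → Fin N) :
    ∑ i, q i * ∏ k, E k (i k) (j k) ∈ Set.Icc (0 : ℝ) (1 / N * (if j j₀ = s then 1 else 0)) :=
  hq.sum_mul_prod_mem j₀ r (j j₀ = s) (fun k a => E k a (j k)) (fun _ => hE.slice _ _)
    fun k hk => ⟨hE.anti_left k hk _, fun _ => hE.mem_Icc k hk _ _⟩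

/-- If `i` avoids the cut layers, or lies beyond one of them, the kernel depends on `j` at most
through the slice condition `j j₀ = s`. There `q` and the uniform weight have equal total mass. -/
theorem sum_right_sub_eq_zero (hE : IsLexKernel j₀ r s b U E)
    {q : (Fin d → Fin N) → ℝ} (hq : IsSliceBounded q)
    (i : Fin d → Fin N)
    (h : (∃ k, k ≠ j₀ ∧ b k < (i k : ℕ)) ∨ ∀ k, k ≠ j₀ → (i k : ℕ) ≠ b k) :
    ∑ j, (q j - 1 / (N : ℝ) ^ d) * ∏ k, E k (i k) (j k) = 0 := by
  by_cases h1 : ∃ k, k ≠ j₀ ∧ b k < (i k : ℕ)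
  · obtain ⟨k, hk, hb⟩ := h1
    exact Finset.sum_eq_zero fun j _ => by
      rw [Finset.prod_eq_zero (Finset.mem_univ k) (hE.eq_zero k hk _ _ hb), mul_zero]
  · have h2 := h.resolve_left h1
    push Not at h1
    have h3 : ∀ j : Fin d → Fin N, ∏ k, E k (i k) (j k) =
        (if i j₀ = r then 1 else 0) * (if j j₀ = s then 1 else 0) := by
      intro j
      rw [← Finset.mul_prod_erase _ _ (Finset.mem_univ j₀), hE.slice, Finset.prod_eq_one, mul_one]
      intro k hk
      have hk' := Finset.ne_of_mem_erase hk
      exact hE.eq_one k hk' _ _ (lt_of_le_of_ne (h1 k hk') (h2 k hk'))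
    simp only [h3]
    have h4 : ∀ j : Fin d → Fin N, (q j - 1 / (N : ℝ) ^ d) *
        ((if i j₀ = r then 1 else 0) * (if j j₀ = s then 1 else 0)) =
        (if i j₀ = r then 1 else 0) * (q j * (if j j₀ = s then 1 else 0) -
          1 / (N : ℝ) ^ d * (if j j₀ = s then 1 else 0)) := fun j => by ring
    rw [Finset.sum_congr rfl fun j _ => h4 j, ← Finset.mul_sum, Finset.sum_sub_distrib,
      hq.sum_slice, isSliceBounded_uniform.sum_slice, sub_self, mul_zero]

/-- Both slice sums lie between `0` and `1 / N`, so they differ by at most `1 / N`; a difference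
occurs only when `i` lies in some cut layer `i l = b l`. The right side is a union bound over `l`.
-/
theorem abs_sum_right_sub_le (hE : IsLexKernel j₀ r s b U E)
    {q : (Fin d → Fin N) → ℝ} (hq : IsSliceBounded q)
    (i : Fin d → Fin N) :
    |∑ j, (q j - 1 / (N : ℝ) ^ d) * ∏ k, E k (i k) (j k)| ≤
      ∑ l ∈ Finset.univ.erase j₀, 1 / N * ∏ k,
        (if k = j₀ then (if i k = r then (1 : ℝ) else 0) else 1) *
        (if k = l then (if (i k : ℕ) = b k then 1 else 0) else 1) := by
  have h0 : ∀ l, (0 : ℝ) ≤ 1 / N * ∏ k,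
        (if k = j₀ then (if i k = r then (1 : ℝ) else 0) else 1) *
        (if k = l then (if (i k : ℕ) = b k then 1 else 0) else 1) := fun l =>
    mul_nonneg (by positivity) (Finset.prod_nonneg fun k _ => by split_ifs <;> simp)
  by_cases h : ∃ l, l ≠ j₀ ∧ (i l : ℕ) = b l
  · obtain ⟨l, hl, hb⟩ := h
    refine le_trans ?_ (Finset.single_le_sum (fun l _ => h0 l)
      (Finset.mem_erase.mpr ⟨hl, Finset.mem_univ l⟩))
    have h1 := hE.sum_right_mem hq i
    have h2 := hE.sum_right_mem isSliceBounded_uniform i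
    simp only [sub_mul, Finset.sum_sub_distrib, Finset.prod_mul_distrib, Finset.prod_ite_eq',
      Finset.mem_univ, if_true, hb, mul_one]
    rw [abs_le]
    exact ⟨by linarith [h1.1, h2.2], by linarith [h1.2, h2.1]⟩
  · push Not at h
    rw [hE.sum_right_sub_eq_zero hq i (Or.inr h), abs_zero]
    exact Finset.sum_nonneg fun l _ => h0 l

/-- Since `ρ` is at most uniform, the conditions `i j₀ = r` and `i l = b l` together carry mass at
most `1 / N ^ 2`. Another factor `1 / N` bounds the inner sum, and there are at most `d` choices of
`l`. -/
theorem abs_sum_mul_sum_right_sub_le (hE : IsLexKernel j₀ r s b U E)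
    {q ρ : (Fin d → Fin N) → ℝ} {δ : ℝ} (hδ : 0 ≤ δ)
    (hρ : IsInterior δ ρ) (hq : IsSliceBounded q) :
    |∑ i, ρ i * ∑ j, (q j - 1 / (N : ℝ) ^ d) * ∏ k, E k (i k) (j k)| ≤ d / N * (1 / N ^ 2) := by
  have hN : (0 : ℝ) < N := by have := r.pos; positivity
  have hρ' : ∀ i, ρ i ≤ 1 / N ^ d := fun i => (hρ.le i).trans (by gcongr; linarith)
  let f : Fin d → Fin d → Fin N → ℝ := fun l k a =>
    (if k = j₀ then (if a = r then (1 : ℝ) else 0) else 1) *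
      (if k = l then (if (a : ℕ) = b k then 1 else 0) else 1)
  have hf : ∀ l, l ≠ j₀ → ∏ k, (1 / (N : ℝ) * ∑ a, f l k a) ≤ 1 / N ^ 2 := by
    intro l hl
    have h1 : ∀ k, 1 / (N : ℝ) * ∑ a, f l k a ≤
        (if k = j₀ then 1 / (N : ℝ) else 1) * (if k = l then 1 / (N : ℝ) else 1) := by
      intro k
      by_cases hk : k = j₀
      · have : k ≠ l := fun h => hl (h.symm.trans hk)
        simp [f, hk, hl.symm]
      · by_cases hkl : k = l
        · have h2 : ∑ a, f l k a ≤ 1 := by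
            simp only [f, if_neg hk, if_pos hkl, one_mul]
            rw [← Finset.sum_filter, Finset.sum_const, nsmul_eq_mul, mul_one]
            have h3 : (Finset.univ.filter fun a : Fin N => (a : ℕ) = b k).card ≤ 1 :=
              Finset.card_le_one.mpr fun x hx y hy => by
                simp only [Finset.mem_filter, Finset.mem_univ, true_and] at hx hy
                exact Fin.ext (hx.trans hy.symm)
            exact_mod_cast h3
          rw [if_neg hk, if_pos hkl, one_mul]
          exact mul_le_of_le_one_right (by positivity) h2
        · simp [f, hk, hkl, hN.ne']
    refine (Finset.prod_le_prod (fun k _ => mul_nonneg (by positivity)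
      (Finset.sum_nonneg fun a _ => ?_)) fun k _ => h1 k).trans ?_
    · simp only [f]
      split_ifs <;> simp
    · rw [Finset.prod_mul_distrib]
      simp only [Finset.prod_ite_eq', Finset.mem_univ, if_true]
      exact le_of_eq (by ring)
  have hnn : ∀ (l : Fin d) (i : Fin d → Fin N), 0 ≤ ∏ k, f l k (i k) := fun l i =>
    Finset.prod_nonneg fun k _ => by simp only [f]; split_ifs <;> simp
  calc |∑ i, ρ i * ∑ j, (q j - 1 / (N : ℝ) ^ d) * ∏ k, E k (i k) (j k)|
      ≤ ∑ i, ρ i * |∑ j, (q j - 1 / (N : ℝ) ^ d) * ∏ k, E k (i k) (j k)| := by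
        refine (Finset.abs_sum_le_sum_abs _ _).trans (le_of_eq ?_)
        exact Finset.sum_congr rfl fun i _ => by rw [abs_mul, abs_of_nonneg (hρ.nonneg i)]
    _ ≤ ∑ i : Fin d → Fin N, 1 / N ^ d * ∑ l ∈ Finset.univ.erase j₀, 1 / N * ∏ k, f l k (i k) := by
        refine Finset.sum_le_sum fun i _ => ?_
        exact mul_le_mul (hρ' i) (hE.abs_sum_right_sub_le hq i) (abs_nonneg _) (by positivity)
    _ = ∑ l ∈ Finset.univ.erase j₀, 1 / N * ∏ k, (1 / (N : ℝ) * ∑ a, f l k a) := by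
        simp only [Finset.mul_sum (Finset.univ.erase j₀)]
        rw [Finset.sum_comm]
        refine Finset.sum_congr rfl fun l _ => ?_
        rw [← sum_uniform_mul_prod, Finset.mul_sum]
        exact Finset.sum_congr rfl fun i _ => by ring
    _ ≤ ∑ l ∈ Finset.univ.erase j₀, 1 / (N : ℝ) * (1 / N ^ 2) :=
        Finset.sum_le_sum fun l hl =>
          mul_le_mul_of_nonneg_left (hf l (Finset.ne_of_mem_erase hl)) (by positivity)
    _ ≤ d / N * (1 / N ^ 2) := by
        rw [Finset.sum_const, nsmul_eq_mul, ← mul_assoc]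
        refine mul_le_mul_of_nonneg_right ?_ (by positivity)
        rw [mul_one_div]
        have : (((Finset.univ.erase j₀).card : ℕ) : ℝ) ≤ d := by
          exact_mod_cast (Finset.card_erase_le).trans (by simp)
        gcongr

/-- Split the sum into `A + B + C` along the three terms of `interlace`. The first two leave a
margin of `δ * V / N ^ 2` below and `δ * (1 - V) / N ^ 2` above. If `C` is not zero, the support of
`ρ` forces `V` into `[δ ^ d, 1 - δ]`, so both margins are at least `δ ^ (d + 1) / N ^ 2`, which
dominates `C`. -/
theorem sum_sum_interlace_mem (hE : IsLexKernel j₀ r s b U E)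
    {q₁ q₂ ρ : (Fin d → Fin N) → ℝ} {δ : ℝ} (hδ : 0 ≤ δ) (hδ' : δ ≤ 1)
    (hd : (d : ℝ) / N ≤ δ ^ (d + 1)) (hρ : IsInterior δ ρ) (hq₁ : IsSliceBounded q₁)
    (hq₂ : IsSliceBounded q₂) :
    ∑ i, ∑ j, interlace ρ q₁ q₂ i j * ∏ k, E k (i k) (j k) ∈ Set.Icc (0 : ℝ) (1 / N ^ 2) := by
  have hN : (0 : ℝ) < N := by have := r.pos; positivity
  have hM : (0 : ℝ) ≤ 1 / N ^ 2 := by positivity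
  set V : ℝ := ∏ k ∈ Finset.univ.erase j₀, U k with hV
  have hV0 : 0 ≤ V := Finset.prod_nonneg fun k _ => (hE.mem_unit k).1
  have hV1 : V ≤ 1 := Finset.prod_le_one (fun k _ => (hE.mem_unit k).1) fun k _ => (hE.mem_unit k).2
  set A : ℝ := ∑ i : Fin d → Fin N, ∑ j : Fin d → Fin N,
    1 / (N : ℝ) ^ d * ((1 / N ^ d - ρ j) * ∏ k, E k (i k) (j k)) with hA
  set B : ℝ := ∑ j, ρ j * ∑ i, q₁ i * ∏ k, E k (i k) (j k) with hB
  set C : ℝ := ∑ i, ρ i * ∑ j, (q₂ j - 1 / (N : ℝ) ^ d) * ∏ k, E k (i k) (j k) with hC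
  have hsum : ∑ i, ∑ j, interlace ρ q₁ q₂ i j * ∏ k, E k (i k) (j k) = A + B + C := by
    have hB' : B = ∑ i, ∑ j, ρ j * (q₁ i * ∏ k, E k (i k) (j k)) := by
      rw [hB, Finset.sum_comm]
      exact Finset.sum_congr rfl fun j _ => Finset.mul_sum _ _ _
    have hC' : C = ∑ i, ∑ j, ρ i * ((q₂ j - 1 / (N : ℝ) ^ d) * ∏ k, E k (i k) (j k)) :=
      Finset.sum_congr rfl fun j _ => Finset.mul_sum _ _ _
    rw [hA, hB', hC']
    simp only [← Finset.sum_add_distrib]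
    exact Finset.sum_congr rfl fun i _ => Finset.sum_congr rfl fun j _ => by
      rw [interlace]
      ring
  have hgap : ∀ j, δ * (1 / N ^ d) ≤ 1 / (N : ℝ) ^ d - ρ j := fun j => by
    have := hρ.le j
    rw [sub_div] at this
    rw [mul_one_div]
    linarith
  have hAlow : δ * (1 / N ^ 2 * V) ≤ A := by
    rw [hV, ← hE.sum_sum_uniform]
    simp only [Finset.mul_sum]
    refine Finset.sum_le_sum fun i _ => Finset.sum_le_sum fun j _ => ?_
    have h1 := mul_le_mul_of_nonneg_right (hgap j) (hE.prod_mem_Icc i j).1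
    have h2 := mul_le_mul_of_nonneg_left h1 (by positivity : (0 : ℝ) ≤ 1 / N ^ d)
    linarith
  have hBlow : 0 ≤ B := Finset.sum_nonneg fun j _ =>
    mul_nonneg (hρ.nonneg j) (hE.sum_left_mem hq₁ j).1
  -- With `w = 1 / N ^ d`, slice indicator `X` and kernel product `P ≤ X`, use `(w - ρ) * P + ρ * X
  -- = w * X - (w - ρ) * (X - P)` together with `w - ρ ≥ δ * w`.
  have hAB : A + B ≤ (1 - δ) * (1 / N ^ 2) + δ * (1 / N ^ 2 * V) := by
    have hX : ∑ i : Fin d → Fin N, 1 / (N : ℝ) ^ d * (if i j₀ = r then 1 else 0) = 1 / N :=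
      isSliceBounded_uniform.sum_slice j₀ r
    have hY : ∑ i : Fin d → Fin N, 1 / (N : ℝ) ^ d * (if i j₀ = s then 1 else 0) = 1 / N :=
      isSliceBounded_uniform.sum_slice j₀ s
    have hB1 : B ≤ ∑ i : Fin d → Fin N, ∑ j, 1 / (N : ℝ) ^ d *
        (ρ j * ((if i j₀ = r then 1 else 0) * (if j j₀ = s then 1 else 0))) := by
      rw [Finset.sum_comm]
      refine Finset.sum_le_sum fun j _ => ?_
      refine (mul_le_mul_of_nonneg_left (hE.sum_left_mem hq₁ j).2 (hρ.nonneg j)).trans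
        (le_of_eq ?_)
      rw [← hX, Finset.sum_mul, Finset.mul_sum]
      exact Finset.sum_congr rfl fun i _ => by ring
    have hXY : (1 - δ) * (1 / (N : ℝ) ^ 2) = ∑ i : Fin d → Fin N, ∑ j : Fin d → Fin N,
        (1 - δ) * ((1 / (N : ℝ) ^ d * (if i j₀ = r then 1 else 0)) *
          (1 / (N : ℝ) ^ d * (if j j₀ = s then 1 else 0))) := by
      calc (1 - δ) * (1 / (N : ℝ) ^ 2) = (1 - δ) * (1 / N * (1 / N)) := by ring
        _ = _ := by
          nth_rewrite 1 [← hX]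
          rw [← hY, Finset.sum_mul_sum, Finset.mul_sum]
          exact Finset.sum_congr rfl fun i _ => Finset.mul_sum _ _ _
    refine (add_le_add_right hB1 A).trans ?_
    rw [hA, ← Finset.sum_add_distrib, hXY, hV, ← hE.sum_sum_uniform, Finset.mul_sum,
      ← Finset.sum_add_distrib]
    refine Finset.sum_le_sum fun i _ => ?_
    rw [← Finset.sum_add_distrib, Finset.mul_sum, ← Finset.sum_add_distrib]
    refine Finset.sum_le_sum fun j _ => ?_
    have h1 := mul_le_mul_of_nonneg_right (hgap j) (sub_nonneg.mpr (hE.prod_mem_Icc i j).2)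
    have h2 := mul_le_mul_of_nonneg_left h1 (by positivity : (0 : ℝ) ≤ 1 / N ^ d)
    linarith
  rw [hsum]
  by_cases hC0 : C = 0
  · rw [hC0, add_zero]
    have h1 : 0 ≤ δ * (1 / N ^ 2 * V) := by positivity
    have h2 : δ * (1 / N ^ 2 * V) ≤ δ * (1 / N ^ 2) :=
      mul_le_mul_of_nonneg_left (mul_le_of_le_one_right hM hV1) hδ
    exact ⟨by linarith, by linarith⟩
  · obtain ⟨i, -, hi⟩ := Finset.exists_ne_zero_of_sum_ne_zero hC0
    have hsupp := hρ.support i (left_ne_zero_of_mul hi)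
    -- A contributing `i` lies in no layer beyond the cut ones and in at least one cut layer `l`.
    -- The first fact bounds every `U k` with `k ≠ j₀` below by `δ`, the second bounds `U l` above
    -- by `1 - δ`.
    have hne := mt (hE.sum_right_sub_eq_zero hq₂ i) (right_ne_zero_of_mul hi)
    push Not at hne
    obtain ⟨hle, l, hl, hbl⟩ := hne
    have hVlow : δ ^ d ≤ V := by
      have h1 : ∀ k ∈ Finset.univ.erase j₀, δ ≤ U k := fun k hk => by
        have h2 : ((i k : ℕ) : ℝ) ≤ b k := by exact_mod_cast hle k (Finset.ne_of_mem_erase hk)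
        have h3 : δ * N ≤ U k * N := by linarith [(hsupp k).1, (hE.floor k).1]
        exact le_of_mul_le_mul_right h3 hN
      calc δ ^ d ≤ δ ^ (Finset.univ.erase j₀).card :=
            pow_le_pow_of_le_one hδ hδ' ((Finset.card_erase_le).trans (by simp))
        _ = ∏ k ∈ Finset.univ.erase j₀, δ := by rw [Finset.prod_const]
        _ ≤ V := Finset.prod_le_prod (fun _ _ => hδ) h1
    have hVup : V ≤ 1 - δ := by
      rw [hV, ← Finset.mul_prod_erase _ _ (Finset.mem_erase.mpr ⟨hl, Finset.mem_univ l⟩)]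
      refine (mul_le_of_le_one_right (hE.mem_unit l).1 (Finset.prod_le_one
        (fun k _ => (hE.mem_unit k).1) fun k _ => (hE.mem_unit k).2)).trans ?_
      have h2 : ((i l : ℕ) : ℝ) = b l := by exact_mod_cast hbl
      have h3 : U l * N ≤ (1 - δ) * N := by linarith [(hsupp l).2, (hE.floor l).2]
      exact le_of_mul_le_mul_right h3 hN
    have hCabs := abs_le.mp ((hE.abs_sum_mul_sum_right_sub_le hδ hρ hq₂).trans
      (mul_le_mul_of_nonneg_right hd hM))
    rw [← hC] at hCabs
    have h1 : δ ^ (d + 1) * (1 / N ^ 2) ≤ δ * (1 / N ^ 2 * V) := by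
      have := mul_le_mul_of_nonneg_left hVlow (mul_nonneg hδ hM)
      rw [pow_succ]
      linarith
    have h2 : δ ^ (d + 1) * (1 / (N : ℝ) ^ 2) ≤ δ * δ * (1 / N ^ 2) := by
      refine mul_le_mul_of_nonneg_right ?_ hM
      rw [← sq]
      exact pow_le_pow_of_le_one hδ hδ' (by have := j₀.pos; omega)
    have h3 := mul_le_mul_of_nonneg_left hVup (mul_nonneg hδ hM)
    exact ⟨by linarith [hCabs.1], by linarith [hCabs.2]⟩

end IsLexKernel

theorem sum_sum_interlace_slice {q₁ q₂ : (Fin d → Fin N) → ℝ} (ρ : (Fin d → Fin N) → ℝ)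
    (hq₁ : IsSliceBounded q₁) (hq₂ : IsSliceBounded q₂) (j₀ : Fin d) (r s : Fin N) :
    ∑ i, ∑ j, interlace ρ q₁ q₂ i j *
      ((if i j₀ = r then 1 else 0) * (if j j₀ = s then 1 else 0)) = 1 / N * (1 / N) := by
  have h1 := isSliceBounded_uniform.sum_slice (d := d) (N := N) j₀
  set X : (Fin d → Fin N) → ℝ := fun i => if i j₀ = r then 1 else 0
  set Y : (Fin d → Fin N) → ℝ := fun j => if j j₀ = s then 1 else 0
  have h2 : ∀ i, ∑ j, interlace ρ q₁ q₂ i j * (X i * Y j) =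
      (1 / (N : ℝ) ^ d * X i) * (1 / N) + (q₁ i * X i - 1 / (N : ℝ) ^ d * X i) * ∑ j, ρ j * Y j := by
    intro i
    calc ∑ j, interlace ρ q₁ q₂ i j * (X i * Y j)
        = ∑ j, ((1 / (N : ℝ) ^ d * X i) * (1 / N ^ d * Y j) +
            (q₁ i * X i - 1 / (N : ℝ) ^ d * X i) * (ρ j * Y j) +
            ρ i * X i * (q₂ j * Y j - 1 / N ^ d * Y j)) :=
          Finset.sum_congr rfl fun j _ => by rw [interlace]; ring
      _ = _ := by
          rw [Finset.sum_add_distrib, Finset.sum_add_distrib,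
            ← Finset.mul_sum _ _ (1 / (N : ℝ) ^ d * X i),
            ← Finset.mul_sum _ _ (q₁ i * X i - 1 / (N : ℝ) ^ d * X i),
            ← Finset.mul_sum _ _ (ρ i * X i), Finset.sum_sub_distrib, h1 s, hq₂.sum_slice j₀ s, sub_self, mul_zero,
            add_zero]
  rw [Finset.sum_congr rfl fun i _ => h2 i, Finset.sum_add_distrib, ← Finset.sum_mul,
    ← Finset.sum_mul, Finset.sum_sub_distrib, h1 r, hq₁.sum_slice j₀ r, sub_self, zero_mul,
    add_zero]

theorem sum_interlace_right {q₁ q₂ : (Fin d → Fin N) → ℝ} (ρ : (Fin d → Fin N) → ℝ)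
    (hq₂ : IsSliceBounded q₂) (hd : 0 < d) (hN : 0 < N) (i : Fin d → Fin N) :
    ∑ j, interlace ρ q₁ q₂ i j = (1 - ∑ j, ρ j) * (1 / N ^ d) + (∑ j, ρ j) * q₁ i := by
  have h1 := isSliceBounded_uniform.sum_eq_one (d := d) hd hN
  simp only [interlace, Finset.sum_add_distrib, ← Finset.mul_sum, Finset.sum_sub_distrib, h1,
    hq₂.sum_eq_one hd hN]
  ring

/-- This symmetry lets one estimate serve both orders of significance. -/
theorem interlace_comm (ρ q₁ q₂ : (Fin d → Fin N) → ℝ) (i j : Fin d → Fin N) :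
    interlace ρ q₁ q₂ i j = interlace ρ q₂ q₁ j i := by
  simp only [interlace]
  ring

end interlace

/-! ### The interlaced quasi-copulas -/

section interlaceFun

variable {d N : ℕ}

/-- The numbering of the fine cells by which the first index is more significant. -/
def lexEquiv (N : ℕ) : Fin N × Fin N ≃ Fin (N * N) := finProdFinEquiv

theorem lexEquiv_val (i j : Fin N) : ((lexEquiv N (i, j) : Fin (N * N)) : ℕ) = j + N * i := rfl

/-- `interlace`, as a weight on the fine cells. -/
noncomputable def interlacePairs (ρ q₁ q₂ : (Fin d → Fin N) → ℝ) (p : Fin d → Fin N × Fin N) : ℝ :=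
  interlace ρ q₁ q₂ (fun k => (p k).1) fun k => (p k).2

theorem sum_interlacePairs_mul (ρ q₁ q₂ : (Fin d → Fin N) → ℝ) (E : Fin d → Fin N × Fin N → ℝ) :
    ∑ p, interlacePairs ρ q₁ q₂ p * ∏ k, E k (p k) =
      ∑ i, ∑ j, interlace ρ q₁ q₂ i j * ∏ k, E k (i k, j k) := by
  rw [← Fintype.sum_prod_type', ← (Equiv.arrowProdEquivProdArrow (Fin d) (fun _ => Fin N)
    (fun _ => Fin N)).sum_comp]
  rfl

/-- The function on the cube with the density `interlacePairs ρ q₁ q₂`. -/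
noncomputable def interlaceFun (ρ q₁ q₂ : (Fin d → Fin N) → ℝ) : (Fin d → I) → ℝ :=
  gridFun (lexEquiv N) (interlacePairs ρ q₁ q₂)

theorem interlaceFun_swap (ρ q₁ q₂ : (Fin d → Fin N) → ℝ) :
    gridFun ((Equiv.prodComm _ _).trans (lexEquiv N)) (interlacePairs ρ q₁ q₂) =
      interlaceFun ρ q₂ q₁ := by
  funext u
  rw [interlaceFun, gridFun, gridFun,
    ← (Equiv.arrowCongr (Equiv.refl (Fin d)) (Equiv.prodComm (Fin N) (Fin N))).sum_comp]
  exact Finset.sum_congr rfl fun p _ => congrArg₂ _ (interlace_comm _ _ _ _ _) rfl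

/-- The fine cells with first index `i` fill the coarse interval from `i / N` to `(i + 1) / N`. Only
the interval with index `⌊N * u k⌋` can be cut by `u k`; earlier ones are full and later ones empty.
-/
theorem isLexKernel_ramp (j₀ : Fin d) (r s : Fin N) (u : Fin d → I) :
    IsLexKernel j₀ r s (fun k => ⌊N * (u k : ℝ)⌋₊) (fun k => u k) (fun k i j =>
      if k = j₀ then (if (i, j) = (r, s) then 1 else 0)
      else ramp (N * N) (lexEquiv N (i, j)) (u k)) where
  slice i j := by
    simp only [if_true, Prod.mk.injEq]
    split_ifs <;> simp_all
  mem_Icc k hk i j := by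
    rw [if_neg hk]
    exact ⟨ramp_nonneg _ _ _, ramp_le_one _ _ _⟩
  anti_left k hk j i i' h := by
    simp only [if_neg hk]
    refine ramp_antitone_index _ _ ?_
    rw [lexEquiv_val, lexEquiv_val]
    have : (i : ℕ) ≤ i' := h
    gcongr
  anti_right k hk i j j' h := by
    simp only [if_neg hk]
    refine ramp_antitone_index _ _ ?_
    rw [lexEquiv_val, lexEquiv_val]
    have : (j : ℕ) ≤ j' := h
    gcongr
  eq_one k hk i j h := by
    rw [if_neg hk]
    apply ramp_eq_one
    have h1 : ((i : ℕ) : ℝ) + 1 ≤ N * u k :=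
      (by exact_mod_cast h : ((i : ℕ) : ℝ) + 1 ≤ (⌊N * (u k : ℝ)⌋₊ : ℕ)).trans
        (Nat.floor_le (mul_nonneg N.cast_nonneg (u k).2.1))
    have h2 := Fin.val_add_one_le_cast j
    have h3 := mul_le_mul_of_nonneg_left h1 (N.cast_nonneg : (0 : ℝ) ≤ N)
    rw [lexEquiv_val]
    push_cast
    linarith
  eq_zero k hk i j h := by
    rw [if_neg hk]
    apply ramp_eq_zero
    have h1 : N * (u k : ℝ) ≤ (i : ℕ) := ((Nat.floor_lt (mul_nonneg N.cast_nonneg (u k).2.1)).mp h).le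
    have h2 : (0 : ℝ) ≤ (j : ℕ) := Nat.cast_nonneg _
    have h3 := mul_le_mul_of_nonneg_left h1 (N.cast_nonneg : (0 : ℝ) ≤ N)
    rw [lexEquiv_val]
    push_cast
    linarith
  sum_eq k hk := by
    simp only [if_neg hk]
    have := sum_ramp_equiv (lexEquiv N) (u k)
    rw [Fintype.sum_prod_type] at this
    rw [this]
    push_cast
    ring
  mem_unit k := (u k).2
  floor k := ⟨Nat.floor_le (mul_nonneg N.cast_nonneg (u k).2.1), (Nat.lt_floor_add_one _).le⟩

theorem isQuasiCopula_interlaceFun (hd : 0 < d) (hN : 0 < N) {q₁ q₂ ρ : (Fin d → Fin N) → ℝ}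
    {δ : ℝ} (hδ : 0 ≤ δ) (hδ' : δ ≤ 1) (hdδ : (d : ℝ) / N ≤ δ ^ (d + 1)) (hρ : IsInterior δ ρ)
    (hq₁ : IsSliceBounded q₁) (hq₂ : IsSliceBounded q₂) :
    IsQuasiCopula (interlaceFun ρ q₁ q₂) := by
  have hslice : ∀ (j : Fin d) (r : Fin N × Fin N) (u : Fin d → I),
      gridSlice (lexEquiv N) (interlacePairs ρ q₁ q₂) j r u =
        ∑ i, ∑ j', interlace ρ q₁ q₂ i j' * ∏ k, (if k = j then (if (i k, j' k) = (r.1, r.2) then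
          1 else 0) else ramp (N * N) (lexEquiv N (i k, j' k)) (u k)) := fun j r u =>
    sum_interlacePairs_mul ρ q₁ q₂ fun k x => if k = j then (if x = r then 1 else 0)
      else ramp (N * N) (lexEquiv N x) (u k)
  have hcast : (1 : ℝ) / (N * N : ℕ) = 1 / N ^ 2 := by
    push_cast
    rw [sq]
  refine isQuasiCopula_gridFun _ _ hd (Nat.mul_pos hN hN) (fun j r u => ?_) fun j r => ?_
  · rw [hslice, hcast]
    exact (isLexKernel_ramp j r.1 r.2 u).sum_sum_interlace_mem hδ hδ' hdδ hρ hq₁ hq₂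
  · rw [hslice, hcast, sq, ← one_div_mul_one_div, ← sum_sum_interlace_slice ρ hq₁ hq₂ j r.1 r.2]
    refine Finset.sum_congr rfl fun i _ => Finset.sum_congr rfl fun j' _ => ?_
    congr 1
    have h1 : ∀ x, ramp (N * N) (lexEquiv N x) ((1 : I) : ℝ) = 1 := fun x => by
      apply ramp_eq_one
      rw [Set.Icc.coe_one, mul_one]
      exact Fin.val_add_one_le_cast _
    simp only [h1, Finset.prod_ite_eq', Finset.mem_univ, if_true, Prod.mk.injEq]
    split_ifs <;> simp_all

/-- At a coarse corner no coarse interval is cut, so the ramps do not depend on the second index,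
and only the first marginal of the weight enters. It is a mixture of the uniform weight and the cell
masses of `Q`. -/
theorem interlaceFun_upperCorner (hd : 0 < d) (hN : 0 < N) {Q : (Fin d → I) → ℝ}
    {q₂ ρ : (Fin d → Fin N) → ℝ} (hq₂ : IsSliceBounded q₂) (b : Fin d → Fin N) :
    interlaceFun ρ (cellMass N Q) q₂ (upperCorner b) =
      (1 - ∑ j, ρ j) * (∏ k, (upperCorner b k : ℝ)) + (∑ j, ρ j) * Q (upperCorner b) := by
  have hN' : (0 : ℝ) < N := by exact_mod_cast hN
  have hc : ∀ k, N * (upperCorner b k : ℝ) = (b k : ℕ) + 1 := fun k => mul_gridPoint hN _ _ _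
  have h1 : ∀ (k : Fin d) (i j : Fin N), ramp (N * N) (lexEquiv N (i, j)) (upperCorner b k) =
      if i ≤ b k then 1 else 0 := by
    intro k i j
    have h2 : ((N * N : ℕ) : ℝ) * (upperCorner b k : ℝ) = N * ((b k : ℕ) + 1) := by
      rw [← hc k]
      push_cast
      ring
    split_ifs with h
    · apply ramp_eq_one
      have h3 : ((i : ℕ) : ℝ) ≤ (b k : ℕ) := by exact_mod_cast h
      have h4 := mul_le_mul_of_nonneg_left h3 hN'.le
      rw [h2, lexEquiv_val]
      push_cast
      linarith [Fin.val_add_one_le_cast j]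
    · apply ramp_eq_zero
      have h3 : ((b k : ℕ) : ℝ) + 1 ≤ (i : ℕ) := by exact_mod_cast not_le.mp h
      have h4 := mul_le_mul_of_nonneg_left h3 hN'.le
      have h5 : (0 : ℝ) ≤ (j : ℕ) := Nat.cast_nonneg _
      rw [h2, lexEquiv_val]
      push_cast
      linarith
  have h2 : ∏ k, (upperCorner b k : ℝ) =
      ∑ i : Fin d → Fin N, 1 / (N : ℝ) ^ d * ∏ k, (if i k ≤ b k then (1 : ℝ) else 0) := by
    rw [sum_uniform_mul_prod fun k a => if a ≤ b k then (1 : ℝ) else 0]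
    refine Finset.prod_congr rfl fun k _ => ?_
    rw [← Finset.sum_filter, Finset.filter_ge_eq_Iic, Finset.sum_const, Fin.card_Iic, nsmul_eq_mul,
      mul_one, one_div, eq_inv_mul_iff_mul_eq₀ hN'.ne', hc]
    push_cast
    ring
  rw [interlaceFun, gridFun,
    sum_interlacePairs_mul ρ _ _ fun k x => ramp (N * N) (lexEquiv N x) (upperCorner b k)]
  simp only [h1]
  rw [← sum_cellMass_le Q b, h2, Finset.mul_sum, Finset.mul_sum, ← Finset.sum_add_distrib]
  refine Finset.sum_congr rfl fun i _ => ?_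
  rw [← Finset.sum_mul, sum_interlace_right ρ hq₂ hd hN]
  ring

theorem exists_upperCorner_near (hN : 0 < N) (u : Fin d → I) :
    ∃ b : Fin d → Fin N, ∑ k, |(u k : ℝ) - upperCorner b k| ≤ d / N := by
  have hN' : (0 : ℝ) < N := by exact_mod_cast hN
  have h : ∀ k, ∃ i : Fin N, ((i : ℕ) : ℝ) ≤ N * (u k : ℝ) ∧ N * (u k : ℝ) ≤ (i : ℕ) + 1 := by
    intro k
    rcases eq_or_lt_of_le (unitInterval.nonneg' : 0 ≤ u k) with h | h
    · exact ⟨⟨0, hN⟩, by simp [← h], by simp [← h]⟩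
    · obtain ⟨i, hi, hi'⟩ := exists_piece hN (u k) h
      exact ⟨i, hi.le, hi'⟩
  choose b hb hb' using h
  refine ⟨b, ?_⟩
  have h1 : ∀ k ∈ Finset.univ, |(u k : ℝ) - upperCorner b k| ≤ 1 / N := by
    intro k _
    have hc : N * (upperCorner b k : ℝ) = (b k : ℕ) + 1 := mul_gridPoint hN _ _ _
    have h2 : (u k : ℝ) - upperCorner b k = (N * u k - ((b k : ℕ) + 1)) / N := by
      rw [← hc]
      field_simp
    rw [h2, abs_div, abs_of_pos hN']
    refine div_le_div_of_nonneg_right (abs_le.mpr ?_) hN'.le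
    exact ⟨by linarith [hb k], by linarith [hb' k]⟩
  refine (Finset.sum_le_sum h1).trans ?_
  simp [div_eq_mul_inv]

/-- Moving to a nearby corner costs `d / N` for each of the two functions. At the corner, the
function differs from `Q` by `1 - ∑ j, ρ j` times a difference of two numbers in `[0, 1]`. -/
theorem abs_interlaceFun_sub_le (hd : 0 < d) (hN : 0 < N) {Q : (Fin d → I) → ℝ}
    (hQ : IsQuasiCopula Q) {q₂ ρ : (Fin d → Fin N) → ℝ} (hq₂ : IsSliceBounded q₂)
    (hA : IsQuasiCopula (interlaceFun ρ (cellMass N Q) q₂)) (hρ : ∑ j, ρ j ≤ 1) (u : Fin d → I) :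
    |Q u - interlaceFun ρ (cellMass N Q) q₂ u| ≤ 2 * (d / N) + (1 - ∑ j, ρ j) := by
  obtain ⟨b, hb⟩ := exists_upperCorner_near hN u
  have h1 := (hQ.abs_sub_le u (upperCorner b)).trans hb
  have h2 := (hA.abs_sub_le u (upperCorner b)).trans hb
  have h3 := interlaceFun_upperCorner (ρ := ρ) (Q := Q) hd hN hq₂ b
  have h4 : (0 : ℝ) ≤ ∏ k, (upperCorner b k : ℝ) :=
    Finset.prod_nonneg fun k _ => (upperCorner b k).2.1
  have h5 : ∏ k, (upperCorner b k : ℝ) ≤ 1 :=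
    Finset.prod_le_one (fun k _ => (upperCorner b k).2.1) fun k _ => (upperCorner b k).2.2
  have h6 := hQ.mem_Icc (upperCorner b)
  have h7 := mul_le_mul_of_nonneg_left
    (by linarith [h6.1] : ∏ k, (upperCorner b k : ℝ) - Q (upperCorner b) ≤ 1) (sub_nonneg.mpr hρ)
  have h8 := mul_le_mul_of_nonneg_left
    (by linarith [h6.2] : -1 ≤ ∏ k, (upperCorner b k : ℝ) - Q (upperCorner b)) (sub_nonneg.mpr hρ)
  rw [abs_le] at h1 h2 ⊢
  exact ⟨by linarith [h1.1, h2.2], by linarith [h1.2, h2.1]⟩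

end interlaceFun

/-! ### An interior weight with large mass -/

/-- A multiple of the uniform weight on the cells at distance at least `L / N` from the boundary of
the cube. -/
noncomputable def interiorWeight (d N L : ℕ) (δ : ℝ) (i : Fin d → Fin N) : ℝ :=
  (1 - δ) * (1 / N ^ d * ∏ k, if L ≤ (i k : ℕ) ∧ (i k : ℕ) < N - L then 1 else 0)

theorem isInterior_interiorWeight (d : ℕ) {N L : ℕ} {δ : ℝ} (hδ : δ ≤ 1) (hL : δ * N = L) :
    IsInterior δ (interiorWeight d N L δ) := by
  have hprod : ∀ i : Fin d → Fin N,
      (∏ k, if L ≤ (i k : ℕ) ∧ (i k : ℕ) < N - L then (1 : ℝ) else 0) ∈ Set.Icc (0 : ℝ) 1 := fun i =>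
    ⟨Finset.prod_nonneg fun k _ => by split_ifs <;> simp,
      Finset.prod_le_one (fun k _ => by split_ifs <;> simp) fun k _ => by split_ifs <;> simp⟩
  refine ⟨fun i => mul_nonneg (by linarith) (mul_nonneg (by positivity) (hprod i).1), fun i => ?_,
    fun i hi k => ?_⟩
  · rw [interiorWeight, div_eq_mul_one_div (1 - δ)]
    exact mul_le_mul_of_nonneg_left (mul_le_of_le_one_right
      (by positivity : (0 : ℝ) ≤ 1 / N ^ d) (hprod i).2)
      (by linarith)
  · have h1 := Finset.prod_ne_zero_iff.mp (right_ne_zero_of_mul (right_ne_zero_of_mul hi)) k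
      (Finset.mem_univ k)
    have h2 : L ≤ (i k : ℕ) ∧ (i k : ℕ) < N - L := by
      by_contra h
      exact h1 (if_neg h)
    have h3 : (i k : ℕ) + 1 + L ≤ N := by omega
    have h4 : ((i k : ℕ) : ℝ) + 1 + L ≤ N := by exact_mod_cast h3
    refine ⟨?_, by linarith⟩
    rw [hL]
    exact_mod_cast h2.1

theorem sum_interiorWeight (d : ℕ) {N L : ℕ} {δ : ℝ} (hN : 0 < N) (hL : δ * N = L)
    (hLN : 2 * L ≤ N) : ∑ i, interiorWeight d N L δ i = (1 - δ) * (1 - 2 * δ) ^ d := by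
  have hN' : (N : ℝ) ≠ 0 := by positivity
  simp only [interiorWeight]
  rw [← Finset.mul_sum, sum_uniform_mul_prod fun (_ : Fin d) (a : Fin N) =>
    if L ≤ (a : ℕ) ∧ (a : ℕ) < N - L then (1 : ℝ) else 0, Finset.prod_const, Finset.card_univ,
    Fintype.card_fin]
  congr 2
  have h1 : ∑ a : Fin N, (if L ≤ (a : ℕ) ∧ (a : ℕ) < N - L then (1 : ℝ) else 0) = N - 2 * L := by
    rw [Fin.sum_univ_eq_sum_range fun a => if L ≤ a ∧ a < N - L then (1 : ℝ) else 0,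
      ← Finset.sum_filter, Finset.sum_const, nsmul_eq_mul, mul_one]
    have h2 : (Finset.range N).filter (fun a => L ≤ a ∧ a < N - L) = Finset.Ico L (N - L) := by
      ext a
      simp only [Finset.mem_filter, Finset.mem_range, Finset.mem_Ico]
      omega
    have h3 : N - L - L = N - 2 * L := by omega
    rw [h2, Nat.card_Ico, h3, Nat.cast_sub hLN]
    push_cast
    ring
  rw [h1, ← hL]
  field_simp

/-! ### Choice of parameters and conclusion -/

theorem exists_isShuffle_near (d : ℕ) [NeZero d] (Q₁ Q₂ : QuasiCopula d) (ε : ℝ) (hε : 0 < ε) :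
    ∃ A₁ A₂ : QuasiCopula d,
      ‖Q₁.1 - A₁.1‖ < ε ∧ ‖Q₂.1 - A₂.1‖ < ε ∧ IsShuffle A₁.1 A₂.1 := by
  have hd : 0 < d := NeZero.pos d
  -- With `δ = 1 / K`, the total error is at most `2 * d * δ` from the corners plus `(2 * d + 1) *
  -- δ` from the missing mass of `ρ`; this gives `4 * d + 1`. The bound `2` keeps the interior of
  -- the cube nonempty.
  obtain ⟨K, hK⟩ := exists_nat_gt (max 2 ((4 * d + 1) / ε))
  have hK2 : (2 : ℝ) < K := (le_max_left _ _).trans_lt hK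
  have hKε : (4 * d + 1) / ε < K := (le_max_right _ _).trans_lt hK
  have hK0 : (0 : ℝ) < K := by linarith
  have hK0' : 0 < K := by exact_mod_cast hK0
  have hK2' : 2 ≤ K := by exact_mod_cast hK2.le
  -- Here `N = d * K ^ (d + 1)`, so `d / N = δ ^ (d + 1)` exactly, and `δ * N = L` is an integer
  -- width for the removed boundary layer.
  set L : ℕ := d * K ^ d with hLdef
  set N : ℕ := K * L with hNdef
  set δ : ℝ := 1 / K with hδdef
  have hL0 : 0 < L := Nat.mul_pos hd (pow_pos hK0' d)
  have hN : 0 < N := Nat.mul_pos hK0' hL0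
  have hδ0 : 0 ≤ δ := by positivity
  have hδ2 : δ ≤ 1 / 2 := one_div_le_one_div_of_le two_pos hK2.le
  have hδ1 : δ ≤ 1 := by linarith
  have hL : δ * N = L := by
    rw [hδdef, hNdef]
    push_cast
    field_simp
  have hLN : 2 * L ≤ N := Nat.mul_le_mul_right L hK2'
  have hdδ : (d : ℝ) / N ≤ δ ^ (d + 1) := by
    have hd' : (0 : ℝ) < d := by exact_mod_cast hd
    rw [hδdef, hNdef, hLdef]
    push_cast
    rw [one_div_pow, pow_succ]
    apply le_of_eq
    field_simp
  have hdN : (d : ℝ) / N ≤ d * δ := by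
    rw [hδdef, mul_one_div]
    have : (K : ℝ) ≤ N := by exact_mod_cast Nat.le_mul_of_pos_right K hL0
    gcongr
  set ρ := interiorWeight d N L δ
  have hρ : IsInterior δ ρ := isInterior_interiorWeight d hδ1 hL
  have hsum : ∑ j, ρ j = (1 - δ) * (1 - 2 * δ) ^ d := sum_interiorWeight d hN hL hLN
  have hpow1 : (1 - 2 * δ) ^ d ≤ 1 := pow_le_one₀ (by linarith) (by linarith)
  -- Bernoulli's inequality.
  have hpow0 : 1 - 2 * d * δ ≤ (1 - 2 * δ) ^ d := by
    have := one_add_mul_le_pow (by linarith : -2 ≤ -(2 * δ)) d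
    rw [← sub_eq_add_neg] at this
    linarith
  have hsum1 : ∑ j, ρ j ≤ 1 := by
    rw [hsum]
    exact mul_le_one₀ (by linarith) (pow_nonneg (by linarith) d) hpow1
  have hsum0 : 1 - ∑ j, ρ j ≤ (2 * d + 1) * δ := by
    rw [hsum]
    have := mul_le_mul_of_nonneg_left hpow1 hδ0
    linarith
  have hq₁ := isSliceBounded_cellMass (N := N) Q₁.2
  have hq₂ := isSliceBounded_cellMass (N := N) Q₂.2
  have hA₁ := isQuasiCopula_interlaceFun hd hN hδ0 hδ1 hdδ hρ hq₁ hq₂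
  have hA₂ := isQuasiCopula_interlaceFun hd hN hδ0 hδ1 hdδ hρ hq₂ hq₁
  have hsmall : 2 * ((d : ℝ) / N) + (1 - ∑ j, ρ j) < ε := by
    have h1 : (4 * d + 1) * δ < ε := by
      rw [hδdef, mul_one_div, div_lt_iff₀ hK0, mul_comm ε, ← div_lt_iff₀ hε]
      exact hKε
    linarith
  refine ⟨⟨⟨_, hA₁.continuous⟩, hA₁⟩, ⟨⟨_, hA₂.continuous⟩, hA₂⟩, ?_, ?_, ?_⟩
  · rw [ContinuousMap.norm_lt_iff _ hε]
    exact fun u => (abs_interlaceFun_sub_le hd hN Q₁.2 hq₂ hA₁ hsum1 u).trans_lt hsmall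
  · rw [ContinuousMap.norm_lt_iff _ hε]
    exact fun u => (abs_interlaceFun_sub_le hd hN Q₂.2 hq₁ hA₂ hsum1 u).trans_lt hsmall
  -- The same weight on pairs is numbered in the two lexicographic orders; the reversed order is
  -- turned into `interlaceFun ρ q₂ q₁` by symmetry.
  · have h := isShuffle_gridFun (Nat.mul_pos hN hN) (lexEquiv N)
      ((Equiv.prodComm _ _).trans (lexEquiv N))
      (interlacePairs ρ (cellMass N Q₁.1) (cellMass N Q₂.1))
      (by rw [interlaceFun_swap]; exact hA₂)
    rw [interlaceFun_swap] at h
    exact h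

theorem mainTheorem3 (d : ℕ) [NeZero d] :
    (∀ (Q₁ Q₂ : QuasiCopula d) (ε : ℝ), 0 < ε →
      ∃ A₁ A₂ : QuasiCopula d,
        ‖Q₁.1 - A₁.1‖ < ε ∧ ‖Q₂.1 - A₂.1‖ < ε ∧ IsShuffle A₁.1 A₂.1) ∧
    (∀ U ∈ 𝓝 (minCopula d),
      Dense {A : QuasiCopula d | (A.1 : (Fin d → I) → ℝ) ∈ shufflesOf U}) := by
  refine ⟨exists_isShuffle_near d, fun U hU Q => ?_⟩
  obtain ⟨r, hr, hball⟩ := Metric.mem_nhds_iff.mp hU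
  rw [Metric.mem_closure_iff]
  intro ε hε
  -- The tolerance `r` puts the approximation `B` of `M` into the given neighborhood, while `ε`
  -- keeps its shuffle `A` close to `Q`.
  obtain ⟨A, B, hA, hB, hAB⟩ := exists_isShuffle_near d Q (minCopula d) (min ε r) (lt_min hε hr)
  refine ⟨A, ⟨B, hball ?_, hAB⟩, ?_⟩
  · rw [Metric.mem_ball', Subtype.dist_eq, dist_eq_norm]
    exact hB.trans_le (min_le_right _ _)
  · rw [Subtype.dist_eq, dist_eq_norm]
    exact hA.trans_le (min_le_left _ _)
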